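/- Let $A$ be a nonzero C$^\ast$-algebra (not necessarily unital or separable), let $S$ be a finite set with $|S|\ge 2$, and let $\mathfrak u=(\upsilon_s)_{s\in S}$ be a family of injective, non-degenerate $\ast$-endomorphisms of $A$ (non-degenerate: sending an approximate unit of $A$ to an approximate unit of $A$). Assume that the only closed two-sided ideals $I$ of $A$ with $\upsilon_s(I)\subset I$ for all $s\in S$ are $I=0$ and $I=A$. Let $\mathcal F_{\mathfrak u}$ be the C$^\ast$-correspondence over $A$ which is $\ell^2(S)\otimes A$ as a right Hilbert $A$-module, with the left $A$-action $$\pi_{\mathfrak u}(a)(\delta_s\otimes b)=\delta_s\otimes\upsilon_s(a)b\qquad(a,b\in A,\ s\in S).$$ Let $\mathrm F(\mathcal F_{\mathfrak u})=\bigoplus_{n\ge0}\mathcal F_{\mathfrak u}^{\otimes n}$ be its full Fock module, where $\mathcal F_{\mathfrak u}^{\otimes 0}=A$, let $\mathcal T_{\mathcal F_{\mathfrak u}}$ be the Toeplitz–Pimsner algebra, that is, the C$^\ast$-algebra of adjointable operators on $\mathrm F(\mathcal F_{\mathfrak u})$ generated by the left action of $A$ and the creation operators $T_\xi\colon\eta\mapsto\xi\otimes\eta$,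 $\xi\in\mathcal F_{\mathfrak u}$, and let $\mathcal O_{\mathcal F_{\mathfrak u}}$ be the Cuntz–Pimsner algebra, that is, the quotient of $\mathcal T_{\mathcal F_{\mathfrak u}}$ by the closed two-sided ideal generated by $\mathcal T_{\mathcal F_{\mathfrak u}}\cap\mathbb K_A(\mathcal F_{\mathfrak u}^{\otimes 0})$. Then $\mathcal O_{\mathcal F_{\mathfrak u}}$ is simple: it is nonzero and its only closed two-sided ideals are $0$ and $\mathcal O_{\mathcal F_{\mathfrak u}}$. -/

import Mathlib

open scoped Topology

noncomputable section

namespace Pimsner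

/-! ### The standard right Hilbert module over a C*-algebra -/

section StandardModule

variable (X A : Type*) [NonUnitalCStarAlgebra A]

theorem summable_of_sq_le {X A : Type*} [NonUnitalCStarAlgebra A] [PartialOrder A]
    [StarOrderedRing A] {f g : X → A} (h0 : ∀ x, 0 ≤ f x) (hfg : ∀ x, f x ≤ g x)
    (hg : Summable g) : Summable f := by
  rw [summable_iff_vanishing_norm] at hg ⊢
  intro ε hε
  obtain ⟨s, hs⟩ := hg ε hε
  refine ⟨s, fun t ht => lt_of_le_of_lt ?_ (hs t ht)⟩
  exact CStarAlgebra.norm_le_norm_of_nonneg_of_le (Finset.sum_nonneg fun i _ => h0 i)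
    (Finset.sum_le_sum fun i _ => hfg i)

/-- The families `f : X → A` such that `∑ f(x)* f(x)` converges in norm. -/
def l2Submodule : Submodule ℂ (X → A) where
  carrier := {f | Summable fun x => star (f x) * f x}
  zero_mem' := by simp
  add_mem' := by
    intro f g hf hg
    let _ := CStarAlgebra.spectralOrder A
    let _ := CStarAlgebra.spectralOrderedRing A
    change Summable fun x => star (f x + g x) * (f x + g x)
    change Summable fun x => star (f x) * f x at hf
    change Summable fun x => star (g x) * g x at hg
    refine summable_of_sq_le (g := fun x => (star (f x) * f x + star (g x) * g x)
      + (star (f x) * f x + star (g x) * g x))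
      (fun x => star_mul_self_nonneg _) (fun x => ?_) ((hf.add hg).add (hf.add hg))
    have h : (0 : A) ≤ star (f x - g x) * (f x - g x) := star_mul_self_nonneg _
    rw [← sub_nonneg]
    convert h using 1
    simp only [star_add, star_sub, add_mul, mul_add, sub_mul, mul_sub]
    abel
  smul_mem' := by
    intro c f hf
    change Summable fun x => star (c • f x) * (c • f x)
    change Summable fun x => star (f x) * f x at hf
    simp only [star_smul, smul_mul_assoc, mul_smul_comm]
    exact (hf.const_smul (star c)).const_smul c

/-- The right Hilbert `A`-module `ℓ²(X) ⊗ A`, realized as the space of all families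
`f : X → A` such that `∑ f(x)* f(x)` converges in norm; the family `f` stands for
`∑ δ_x ⊗ f(x)`. -/
def StdModule : Type _ := ↥(l2Submodule X A)

end StandardModule

namespace StdModule

variable {X A : Type*} [NonUnitalCStarAlgebra A]

instance : AddCommGroup (StdModule X A) := inferInstanceAs (AddCommGroup ↥(l2Submodule X A))

instance : Module ℂ (StdModule X A) := inferInstanceAs (Module ℂ ↥(l2Submodule X A))

instance : CoeFun (StdModule X A) (fun _ => X → A) := ⟨fun f => f.1⟩

/-- The element of `ℓ²(X) ⊗ A` given by a square summable family. -/
def ofFun (f : X → A) (hf : Summable fun x => star (f x) * f x) : StdModule X A := ⟨f, hf⟩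

@[ext] theorem ext {f g : StdModule X A} (h : ∀ x, f x = g x) : f = g := Subtype.ext (funext h)

@[simp] theorem add_apply (f g : StdModule X A) (x : X) : (f + g) x = f x + g x := rfl

@[simp] theorem smul_apply (c : ℂ) (f : StdModule X A) (x : X) : (c • f) x = c • f x := rfl

@[simp] theorem zero_apply (x : X) : (0 : StdModule X A) x = 0 := rfl

/-- The `A`-valued inner product `⟨f, g⟩ = ∑ f(x)* g(x)`, conjugate linear in the first variable. -/
def ip (f g : StdModule X A) : A := ∑' x, star (f x) * g x

/-- The series defining the inner product converges. -/
theorem summable_ip (f g : StdModule X A) : Summable fun x => star (f x) * g x := by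
  have key (c : ℂ) : Summable fun x => star c • (star ((f + c • g) x) * (f + c • g) x) :=
    (f + c • g).2.const_smul (star c)
  have h := ((((key 1).add (key (-1))).add (key Complex.I)).add (key (-Complex.I))).const_smul
    (1 / 4 : ℂ)
  convert h using 2 with x
  have hI : Complex.I * Complex.I = -1 := Complex.I_mul_I
  simp only [add_apply, smul_apply, star_add, star_smul, add_mul, mul_add, smul_add,
    smul_mul_assoc, mul_smul_comm, smul_smul, RCLike.star_def, map_one, map_neg, Complex.conj_I]
  match_scalars <;> (ring_nf; try norm_num)

theorem hasSum_ip (f g : StdModule X A) : HasSum (fun x => star (f x) * g x) (ip f g) :=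
  (summable_ip f g).hasSum

/-- The norm `‖f‖ = ‖⟨f, f⟩‖ ^ (1/2)` of the Hilbert module. -/
instance : Norm (StdModule X A) := ⟨fun f => √‖ip f f‖⟩

theorem norm_def (f : StdModule X A) : ‖f‖ = √‖ip f f‖ := rfl

theorem ip_add_right (f g h : StdModule X A) : ip f (g + h) = ip f g + ip f h := by
  refine (hasSum_ip f (g + h)).unique ?_
  simpa [mul_add] using (hasSum_ip f g).add (hasSum_ip f h)

theorem ip_smul_right (c : ℂ) (f g : StdModule X A) : ip f (c • g) = c • ip f g := by
  refine (hasSum_ip f (c • g)).unique ?_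
  simpa [mul_smul_comm] using (hasSum_ip f g).const_smul c

theorem star_ip (f g : StdModule X A) : star (ip f g) = ip g f := by
  refine HasSum.unique ?_ (hasSum_ip g f)
  simpa using (hasSum_ip f g).star

theorem ip_self_eq_zero {f : StdModule X A} : ip f f = 0 ↔ f = 0 := by
  let _ := CStarAlgebra.spectralOrder A
  let _ := CStarAlgebra.spectralOrderedRing A
  constructor
  · intro h
    have hs := hasSum_ip f f
    rw [h, hasSum_zero_iff_of_nonneg (fun x => star_mul_self_nonneg _)] at hs
    ext x
    simpa [CStarRing.star_mul_self_eq_zero_iff] using congrFun hs x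
  · rintro rfl
    simp [ip]

/-- The right action of `A`: `(f a)(x) = f(x) a`. -/
def rmul (f : StdModule X A) (a : A) : StdModule X A :=
  ⟨fun x => f x * a, by
    change Summable fun x => star (f x * a) * (f x * a)
    simpa [mul_assoc] using (f.2.mul_left (star a)).mul_right a⟩

@[simp] theorem rmul_apply (f : StdModule X A) (a : A) (x : X) : rmul f a x = f x * a := rfl

theorem ip_rmul_right (f g : StdModule X A) (a : A) : ip f (rmul g a) = ip f g * a := by
  refine (hasSum_ip f (rmul g a)).unique ?_
  simpa [mul_assoc] using (hasSum_ip f g).mul_right a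

theorem ip_self_nonneg [PartialOrder A] [StarOrderedRing A] (f : StdModule X A) :
    0 ≤ ip f f := (hasSum_ip f f).nonneg fun _ => star_mul_self_nonneg _

instance : SMul Aᵐᵒᵖ (StdModule X A) := ⟨fun a f => rmul f a.unop⟩

/-- `ℓ²(X) ⊗ A` is a Hilbert C*-module in the sense of Mathlib. Mathlib's convention is that of
left modules, so a right Hilbert `A`-module is a Hilbert module over the opposite algebra. -/
abbrev cstarModule [PartialOrder A] [StarOrderedRing A] :
    CStarModule Aᵐᵒᵖ (StdModule X A) where
  inner f g := MulOpposite.op (ip f g)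
  inner_add_right := by intro f g h; simp [ip_add_right]
  inner_self_nonneg := by intro f; exact ip_self_nonneg f
  inner_self := by intro f; simp [ip_self_eq_zero]
  inner_op_smul_right := by
    intro a f g
    exact congrArg MulOpposite.op (ip_rmul_right f g a.unop)
  inner_smul_right_complex := by intro c f g; simp [ip_smul_right]
  star_inner f g := by rw [← MulOpposite.op_star, star_ip]
  norm_eq_sqrt_norm_inner_self f := rfl

theorem core : NormedSpace.Core ℂ (StdModule X A) := by
  let _ := CStarAlgebra.spectralOrder A
  let _ := CStarAlgebra.spectralOrderedRing A
  let _ := cstarModule (X := X) (A := A)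
  exact CStarModule.normedSpaceCore Aᵐᵒᵖ

instance : NormedAddCommGroup (StdModule X A) := NormedAddCommGroup.ofCore core

instance : NormedSpace ℂ (StdModule X A) := NormedSpace.ofCore core

/-- Cauchy-Schwarz. -/
theorem norm_ip_le (f g : StdModule X A) : ‖ip f g‖ ≤ ‖f‖ * ‖g‖ := by
  let _ := CStarAlgebra.spectralOrder A
  let _ := CStarAlgebra.spectralOrderedRing A
  let _ := cstarModule (X := X) (A := A)
  exact CStarModule.norm_inner_le (A := Aᵐᵒᵖ) (StdModule X A) (x := f) (y := g)

theorem norm_sq (f : StdModule X A) : ‖f‖ ^ 2 = ‖ip f f‖ := by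
  rw [norm_def, Real.sq_sqrt (norm_nonneg _)]

theorem norm_le_of_ip_le {f : StdModule X A} {C : ℝ} (hC : 0 ≤ C) (h : ‖ip f f‖ ≤ C ^ 2) :
    ‖f‖ ≤ C := by
  rw [← norm_sq] at h
  exact abs_le_of_sq_le_sq' h hC |>.2

theorem eq_of_ip_eq {f g : StdModule X A} (h : ∀ k, ip k f = ip k g) : f = g := by
  have h1 : ip (f - g) (f - g) = 0 := by
    have h2 := ip_add_right (f - g) (f - g) g
    rw [sub_add_cancel, h (f - g)] at h2
    simpa using h2
  exact sub_eq_zero.mp (ip_self_eq_zero.mp h1)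

end StdModule

open StdModule

/-! ### Adjointable operators and compact operators -/

section Operators

variable {X A : Type*} [NonUnitalCStarAlgebra A]

/-- `T'` is an adjoint of `T`: `⟨T f, g⟩ = ⟨f, T' g⟩` for all `f`, `g`. -/
def IsAdj (T T' : StdModule X A →L[ℂ] StdModule X A) : Prop :=
  ∀ f g, ip (T f) g = ip f (T' g)

theorem IsAdj.symm {T T' : StdModule X A →L[ℂ] StdModule X A} (h : IsAdj T T') : IsAdj T' T := by
  intro f g
  rw [← star_ip, ← h g f, star_ip]

theorem IsAdj.unique {T T' T'' : StdModule X A →L[ℂ] StdModule X A} (h : IsAdj T T')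
    (h' : IsAdj T T'') : T' = T'' := by
  ext1 g
  exact eq_of_ip_eq fun k => by rw [← h, h']

theorem ip_add_left (f g h : StdModule X A) : ip (f + g) h = ip f h + ip g h := by
  rw [← star_ip, ip_add_right, star_add, star_ip, star_ip]

theorem ip_smul_left (c : ℂ) (f g : StdModule X A) : ip (c • f) g = star c • ip f g := by
  rw [← star_ip, ip_smul_right, star_smul, star_ip]

variable (X A) in
/-- The algebra `𝔹_A(ℓ²(X) ⊗ A)` of all bounded adjointable operators, with the operator norm. -/
def Adjointable : Subalgebra ℂ (StdModule X A →L[ℂ] StdModule X A) where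
  carrier := {T | ∃ T', IsAdj T T'}
  mul_mem' := by
    rintro S T ⟨S', hS⟩ ⟨T', hT⟩
    exact ⟨T' * S', fun f g => (hS (T f) g).trans (hT f (S' g))⟩
  add_mem' := by
    rintro S T ⟨S', hS⟩ ⟨T', hT⟩
    refine ⟨S' + T', fun f g => ?_⟩
    simp [ip_add_left, ip_add_right, hS f g, hT f g]
  algebraMap_mem' := by
    intro c
    refine ⟨algebraMap ℂ _ (star c), fun f g => ?_⟩
    simp [Algebra.algebraMap_eq_smul_one, ip_smul_left, ip_smul_right]

namespace Adjointable

instance : NormedRing (Adjointable X A) := inferInstance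

instance : NormedAlgebra ℂ (Adjointable X A) := inferInstance

/-- The adjointable operator given by a pair of mutually adjoint operators. -/
def mk (T T' : StdModule X A →L[ℂ] StdModule X A) (h : IsAdj T T') : Adjointable X A :=
  ⟨T, T', h⟩

/-- The involution of `𝔹_A(ℓ²(X) ⊗ A)` is the adjoint. -/
instance : Star (Adjointable X A) := ⟨fun T => ⟨T.2.choose, T.1, T.2.choose_spec.symm⟩⟩

theorem isAdj_star (T : Adjointable X A) : IsAdj T.1 (star T).1 := T.2.choose_spec

theorem star_eq_of_isAdj {T S : Adjointable X A} (h : IsAdj T.1 S.1) : star T = S :=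
  Subtype.ext ((isAdj_star T).unique h)

@[simp] theorem star_mk (T T' : StdModule X A →L[ℂ] StdModule X A) (h : IsAdj T T') :
    star (mk T T' h) = mk T' T h.symm := star_eq_of_isAdj h

theorem ip_apply_left (T : Adjointable X A) (f g : StdModule X A) :
    ip (T.1 f) g = ip f ((star T).1 g) := isAdj_star T f g

instance : StarRing (Adjointable X A) where
  star_involutive T := star_eq_of_isAdj (isAdj_star T).symm
  star_mul S T := star_eq_of_isAdj fun f g =>
    (isAdj_star S (T.1 f) g).trans (isAdj_star T f ((star S).1 g))
  star_add S T := star_eq_of_isAdj fun f g => by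
    simp [ip_add_left, ip_add_right, ip_apply_left]

instance : StarModule ℂ (Adjointable X A) where
  star_smul c T := star_eq_of_isAdj fun f g => by
    simp [ip_smul_left, ip_smul_right, ip_apply_left]

theorem ext_apply {T T' : Adjointable X A} (h : ∀ f x, T.1 f x = T'.1 f x) : T = T' :=
  Subtype.ext (ContinuousLinearMap.ext fun f => StdModule.ext (h f))

theorem mul_apply (T T' : Adjointable X A) (f : StdModule X A) (x : X) :
    (T * T').1 f x = T.1 (T'.1 f) x := rfl

theorem sum_apply {ι : Type*} (s : Finset ι) (T : ι → Adjointable X A) (f : StdModule X A)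
    (x : X) : (∑ i ∈ s, T i).1 f x = ∑ i ∈ s, (T i).1 f x :=
  map_sum (AddMonoidHom.mk' (fun T : Adjointable X A => T.1 f x) fun _ _ => rfl) T s

/-- The C*-identity. -/
instance : CStarRing (Adjointable X A) where
  norm_mul_self_le T := by
    change ‖T.1‖ * ‖T.1‖ ≤ ‖(star T * T).1‖
    rw [← sq, ← Real.le_sqrt (norm_nonneg _) (norm_nonneg _)]
    refine ContinuousLinearMap.opNorm_le_bound _ (Real.sqrt_nonneg _) fun f => ?_
    refine norm_le_of_ip_le (by positivity) ?_
    rw [ip_apply_left, mul_pow, Real.sq_sqrt (norm_nonneg _)]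
    calc ‖ip f ((star T * T).1 f)‖ ≤ ‖f‖ * ‖(star T * T).1 f‖ := norm_ip_le _ _
      _ ≤ ‖f‖ * (‖(star T * T).1‖ * ‖f‖) := by
        gcongr; exact ContinuousLinearMap.le_opNorm _ _
      _ = ‖(star T * T).1‖ * ‖f‖ ^ 2 := by ring

instance : NormedStarGroup (Adjointable X A) := inferInstance

instance : ContinuousStar (Adjointable X A) := inferInstance

/-- The rank one operator `θ_{ξ,η}(ζ) = ξ ⟨η, ζ⟩`. -/
def theta (ξ η : StdModule X A) : Adjointable X A :=
  have bd (ξ η ζ : StdModule X A) : ‖rmul ξ (ip η ζ)‖ ≤ (‖ξ‖ * ‖η‖) * ‖ζ‖ := by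
    refine norm_le_of_ip_le (by positivity) ?_
    have h : ip (rmul ξ (ip η ζ)) (rmul ξ (ip η ζ)) = star (ip η ζ) * ip ξ ξ * ip η ζ := by
      rw [ip_rmul_right, ← star_ip, ip_rmul_right, star_mul, star_ip,
        star_ip]
    calc _ ≤ ‖ip η ζ‖ * ‖ip ξ ξ‖ * ‖ip η ζ‖ := by
          rw [h]
          exact (norm_mul_le _ _).trans (by gcongr; simpa using norm_mul_le (star (ip η ζ)) _)
      _ ≤ (‖η‖ * ‖ζ‖) * ‖ξ‖ ^ 2 * (‖η‖ * ‖ζ‖) := by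
          rw [norm_sq]; gcongr <;> exact norm_ip_le _ _
      _ = _ := by ring
  let op (ξ η : StdModule X A) : StdModule X A →L[ℂ] StdModule X A :=
    LinearMap.mkContinuous
      { toFun := fun ζ => rmul ξ (ip η ζ)
        map_add' := fun ζ ζ' => by ext x; simp [ip_add_right, mul_add]
        map_smul' := fun c ζ => by ext x; simp [ip_smul_right, mul_smul_comm] }
      (‖ξ‖ * ‖η‖) (bd ξ η)
  mk (op ξ η) (op η ξ) (by
    intro f g
    change ip (rmul ξ (ip η f)) g = ip f (rmul η (ip ξ g))
    rw [ip_rmul_right, ← star_ip, ip_rmul_right, star_mul, star_ip, star_ip])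

@[simp] theorem theta_apply (ξ η ζ : StdModule X A) :
    (theta ξ η).1 ζ = rmul ξ (ip η ζ) := rfl

/-- The compact operators of the direct summand `ℓ²(Y) ⊗ A`, `Y ⊆ X`, regarded as operators on
`ℓ²(X) ⊗ A`: the closed linear span of the `θ_{ξ,η}` with `ξ`, `η` supported in `Y`. -/
def compactOn (Y : Set X) : Set (Adjointable X A) :=
  closure (Submodule.span ℂ {T : Adjointable X A | ∃ ξ η : StdModule X A,
    (∀ x ∉ Y, ξ x = 0) ∧ (∀ x ∉ Y, η x = 0) ∧ T = theta ξ η} : Set (Adjointable X A))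

/-- The diagonal operator `δ_x ⊗ b ↦ δ_x ⊗ c(x) b` of a bounded family `c` in `A`. -/
def diag (c : X → A) (hc : ∃ C : ℝ, ∀ x, ‖c x‖ ≤ C) : Adjointable X A :=
  have mem (c : X → A) (C : ℝ) (hC : ∀ x, ‖c x‖ ≤ C) (f : StdModule X A) :
      ∃ h : Summable fun x => star (c x * f x) * (c x * f x),
        ‖ofFun (fun x => c x * f x) h‖ ≤ C * ‖f‖ := by
    let _ := CStarAlgebra.spectralOrder A
    let _ := CStarAlgebra.spectralOrderedRing A
    have hle (x : X) : star (c x * f x) * (c x * f x) ≤ (C ^ 2) • (star (f x) * f x) := by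
      have h1 := CStarAlgebra.star_left_conjugate_le_norm_smul (a := f x) (b := star (c x) * c x)
        (IsSelfAdjoint.star_mul_self _)
      have h2 : ‖star (c x) * c x‖ ≤ C ^ 2 := by
        rw [CStarRing.norm_star_mul_self, ← sq]
        exact pow_le_pow_left₀ (norm_nonneg _) (hC x) 2
      have h3 := smul_le_smul_of_nonneg_right h2 (star_mul_self_nonneg (f x))
      simpa [mul_assoc] using h1.trans h3
    have hs : Summable fun x => star (c x * f x) * (c x * f x) :=
      summable_of_sq_le (fun x => star_mul_self_nonneg _) hle (f.2.const_smul (C ^ 2))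
    refine ⟨hs, ?_⟩
    rcases isEmpty_or_nonempty X with hX | ⟨⟨x⟩⟩
    · have hf : f = 0 := by ext x; exact hX.elim x
      have : ofFun (fun x => c x * f x) hs = 0 := by ext x; exact hX.elim x
      rw [this, hf]; simp
    have hC0 : 0 ≤ C := (norm_nonneg _).trans (hC x)
    refine norm_le_of_ip_le (by positivity) ?_
    have h1 : ip (ofFun (fun x => c x * f x) hs) (ofFun (fun x => c x * f x) hs)
        ≤ (C ^ 2) • ip f f :=
      hasSum_le hle hs.hasSum ((hasSum_ip f f).const_smul (C ^ 2))
    calc _ ≤ ‖(C ^ 2) • ip f f‖ :=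
          CStarAlgebra.norm_le_norm_of_nonneg_of_le (ip_self_nonneg _) h1
      _ = (C * ‖f‖) ^ 2 := by rw [norm_smul, mul_pow, norm_sq]; simp
  let op (c : X → A) (hc : ∃ C : ℝ, ∀ x, ‖c x‖ ≤ C) : StdModule X A →L[ℂ] StdModule X A :=
    LinearMap.mkContinuous
      { toFun := fun f => ofFun (fun x => c x * f x) (mem c hc.choose hc.choose_spec f).choose
        map_add' := fun f g => StdModule.ext fun x => mul_add _ _ _
        map_smul' := fun r f => StdModule.ext fun x => mul_smul_comm _ _ _ }
      hc.choose (fun f => (mem c hc.choose hc.choose_spec f).choose_spec)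
  mk (op c hc) (op (fun x => star (c x)) (by simpa using hc)) (by
    intro f g
    change ∑' x, star (c x * f x) * g x = ∑' x, star (f x) * (star (c x) * g x)
    simp [mul_assoc])

@[simp] theorem diag_apply (c : X → A) (hc : ∃ C : ℝ, ∀ x, ‖c x‖ ≤ C) (f : StdModule X A) (x : X) :
    (diag c hc).1 f x = c x * f x := rfl

theorem hasSum_extend (j : X → X) (hj : Function.Injective j) (f : StdModule X A) (k : A → A → A)
    (hk : ∀ a, k a 0 = 0) (g : X → A) (a : A) (h : HasSum (fun x => k (g (j x)) (f x)) a) :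
    HasSum (fun y => k (g y) (Function.extend j f 0 y)) a := by
  rw [← hj.hasSum_iff]
  · simpa [Function.comp_def, hj.extend_apply] using h
  · intro y hy
    rw [Function.extend_apply' _ _ _ (by simpa using hy)]
    simp [hk]

/-- The operator `δ_x ⊗ b ↦ δ_{j x} ⊗ b` for an injective map `j`. -/
def pushCLM (j : X → X) (hj : Function.Injective j) : StdModule X A →L[ℂ] StdModule X A :=
  have sf (f : StdModule X A) :
      HasSum (fun y => star (Function.extend j f 0 y) * Function.extend j f 0 y) (ip f f) :=
    hasSum_extend j hj f (fun _ b => star b * b) (by simp) 0 _ (hasSum_ip f f)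
  LinearMap.mkContinuous
    { toFun := fun f => ⟨Function.extend j f 0, (sf f).summable⟩
      map_add' := fun f g => StdModule.ext fun y => by
        change Function.extend j (f + g).1 0 y
          = Function.extend j f 0 y + Function.extend j g 0 y
        by_cases hy : ∃ x, j x = y
        · obtain ⟨x, rfl⟩ := hy
          simp only [hj.extend_apply]; rfl
        · simp [Function.extend_apply' _ _ _ hy]
      map_smul' := fun c f => StdModule.ext fun y => by
        change Function.extend j (c • f).1 0 y = c • Function.extend j f 0 y
        by_cases hy : ∃ x, j x = y
        · obtain ⟨x, rfl⟩ := hy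
          simp only [hj.extend_apply]; rfl
        · simp [Function.extend_apply' _ _ _ hy] }
    1 (fun f => norm_le_of_ip_le (by positivity) (by
      rw [one_mul, norm_sq]
      exact le_of_eq (congrArg _ ((hasSum_ip _ _).unique (sf f)))))

/-- The operator `f ↦ f ∘ j` for an injective map `j`. -/
def pullCLM (j : X → X) (hj : Function.Injective j) : StdModule X A →L[ℂ] StdModule X A :=
  have sg (f : StdModule X A) : Summable fun x => star (f (j x)) * f (j x) :=
    f.2.comp_injective hj
  LinearMap.mkContinuous
    { toFun := fun f => ⟨fun x => f (j x), sg f⟩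
      map_add' := fun f g => rfl
      map_smul' := fun c f => rfl }
    1 (fun f => norm_le_of_ip_le (by positivity) (by
      rw [one_mul, norm_sq]
      let _ := CStarAlgebra.spectralOrder A
      let _ := CStarAlgebra.spectralOrderedRing A
      refine CStarAlgebra.norm_le_norm_of_nonneg_of_le (ip_self_nonneg _) ?_
      exact hasSum_le_inj j hj (fun _ _ => star_mul_self_nonneg _) (fun _ => le_rfl)
        (sg f).hasSum (hasSum_ip f f)))

theorem shift_aux (j : X → X) (hj : Function.Injective j) :
    IsAdj (pushCLM (A := A) j hj) (pullCLM j hj) := by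
  intro f g
  refine (hasSum_ip _ _).unique ?_
  exact hasSum_extend j hj f (fun a b => star b * a) (by simp) g _ (hasSum_ip f (pullCLM j hj g))

/-- The isometry `δ_x ⊗ b ↦ δ_{j x} ⊗ b` of an injective map `j`. -/
def shift (j : X → X) (hj : Function.Injective j) : Adjointable X A :=
  mk (pushCLM j hj) (pullCLM j hj) (shift_aux j hj)

theorem shift_apply (j : X → X) (hj : Function.Injective j) (f : StdModule X A) (y : X) :
    (shift j hj).1 f y = Function.extend j f 0 y := rfl

theorem star_diag_apply (c : X → A) (hc : ∃ C : ℝ, ∀ x, ‖c x‖ ≤ C) (f : StdModule X A) (x : X) :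
    (star (diag c hc)).1 f x = star (c x) * f x := by
  have h : star (diag c hc) = diag (fun x => star (c x)) (by simpa using hc) :=
    star_eq_of_isAdj fun f g => by
      change ∑' x, star (c x * f x) * g x = ∑' x, star (f x) * (star (c x) * g x)
      simp [mul_assoc]
  rw [h, diag_apply]

theorem star_shift_apply (j : X → X) (hj : Function.Injective j) (f : StdModule X A) (x : X) :
    (star (shift j hj)).1 f x = f (j x) := by
  have h := star_mk _ _ (shift_aux (A := A) j hj)
  exact congrArg (fun T : Adjointable X A => T.1 f x) h

end Adjointable

end Operators

/-! ### The correspondence, its Fock module, and the Pimsner algebras -/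

section Fock

variable {S A : Type*} [NonUnitalCStarAlgebra A]

/-- `υ_w = υ_{s_n} ∘ ⋯ ∘ υ_{s_1}` for a word `w = (s_1, …, s_n)`. -/
def wordHom (u : S → A →⋆ₙₐ[ℂ] A) : List S → A →⋆ₙₐ[ℂ] A
  | [] => NonUnitalStarAlgHom.id ℂ A
  | s :: w => (wordHom u w).comp (u s)

theorem bounded_apply {X : Type*} (φ : X → A →⋆ₙₐ[ℂ] A) (a : A) :
    ∃ C : ℝ, ∀ x, ‖φ x a‖ ≤ C :=
  ⟨‖a‖, fun x => NonUnitalStarAlgHom.norm_apply_le (φ x) a⟩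

variable (S A) in
/-- The right Hilbert module `ℓ²(S) ⊗ A` underlying the correspondence `F_u`. -/
abbrev Corr : Type _ := StdModule S A

/-- The left action `π_u(a)(δ_s ⊗ b) = δ_s ⊗ υ_s(a) b` of the correspondence `F_u`. -/
def corrAction (u : S → A →⋆ₙₐ[ℂ] A) (a : A) : Adjointable S A :=
  Adjointable.diag (fun s => u s a) (bounded_apply u a)

variable (S A) in
/-- The full Fock module of `F_u`: the direct sum of the tensor powers `F_u^{⊗ n}`. As usual
`F_u^{⊗ n}` is identified with `ℓ²(Sⁿ) ⊗ A`, the tensor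
`(δ_{s_1} ⊗ a_1) ⊗ ⋯ ⊗ (δ_{s_n} ⊗ a_n)` corresponding to
`δ_{(s_1, …, s_n)} ⊗ υ_{(s_2, …, s_n)}(a_1) υ_{(s_3, …, s_n)}(a_2) ⋯ a_n`, so that the Fock
module is `ℓ²` of the set of all finite words in `S`, tensored with `A`. -/
abbrev Fock : Type _ := StdModule (List S) A

/-- The left action of `A` on the Fock module, `a (δ_w ⊗ b) = δ_w ⊗ υ_w(a) b`. -/
def fockAction (u : S → A →⋆ₙₐ[ℂ] A) (a : A) : Adjointable (List S) A :=
  Adjointable.diag (fun w => wordHom u w a) (bounded_apply (wordHom u) a)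

variable [Fintype S]

/-- The creation operator `T_ξ : η ↦ ξ ⊗ η` on the Fock module, for `ξ = ∑ δ_s ⊗ ξ(s)` in `F_u`:
it sends `δ_w ⊗ b` to `∑ δ_{s w} ⊗ υ_w(ξ(s)) b`. -/
def creation (u : S → A →⋆ₙₐ[ℂ] A) (ξ : Corr S A) : Adjointable (List S) A :=
  ∑ s, Adjointable.shift (fun w => s :: w) (List.cons_injective) * fockAction u (ξ s)

theorem creation_apply_nil (u : S → A →⋆ₙₐ[ℂ] A) (ξ : Corr S A) (f : Fock S A) :
    (creation u ξ).1 f [] = 0 := by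
  rw [creation, Adjointable.sum_apply]
  refine Finset.sum_eq_zero fun s _ => ?_
  rw [Adjointable.mul_apply, Adjointable.shift_apply, Function.extend_apply' _ _ _ (by simp)]
  rfl

theorem creation_apply_cons (u : S → A →⋆ₙₐ[ℂ] A) (ξ : Corr S A) (f : Fock S A) (s : S)
    (w : List S) : (creation u ξ).1 f (s :: w) = wordHom u w (ξ s) * f w := by
  rw [creation, Adjointable.sum_apply, Finset.sum_eq_single s]
  · rw [Adjointable.mul_apply, Adjointable.shift_apply, List.cons_injective.extend_apply]
    rfl
  · intro t _ ht
    rw [Adjointable.mul_apply, Adjointable.shift_apply, Function.extend_apply' _ _ _ (by simp [ht])]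
    rfl
  · simp

theorem star_creation_apply (u : S → A →⋆ₙₐ[ℂ] A) (ξ : Corr S A) (f : Fock S A) (w : List S) :
    (star (creation u ξ)).1 f w = ∑ s, star (wordHom u w (ξ s)) * f (s :: w) := by
  rw [creation, star_sum, Adjointable.sum_apply]
  refine Finset.sum_congr rfl fun s _ => ?_
  rw [star_mul, Adjointable.mul_apply, fockAction, Adjointable.star_diag_apply,
    Adjointable.star_shift_apply]

/-- The relation `T_ξ* T_η = ⟨ξ, η⟩`. -/
theorem star_creation_mul_creation (u : S → A →⋆ₙₐ[ℂ] A) (ξ η : Corr S A) :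
    star (creation u ξ) * creation u η = fockAction u (ip ξ η) := by
  refine Adjointable.ext_apply fun f w => ?_
  rw [Adjointable.mul_apply, star_creation_apply, fockAction, Adjointable.diag_apply, ip,
    tsum_fintype, map_sum, Finset.sum_mul]
  refine Finset.sum_congr rfl fun s _ => ?_
  rw [creation_apply_cons, map_mul, map_star, mul_assoc]

/-- The relation `a T_ξ = T_{a ξ}`. -/
theorem fockAction_mul_creation (u : S → A →⋆ₙₐ[ℂ] A) (a : A) (ξ : Corr S A) :
    fockAction u a * creation u ξ = creation u ((corrAction u a).1 ξ) := by
  refine Adjointable.ext_apply fun f v => ?_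
  rw [Adjointable.mul_apply, fockAction, Adjointable.diag_apply]
  cases v with
  | nil => rw [creation_apply_nil, creation_apply_nil, mul_zero]
  | cons s w =>
    rw [creation_apply_cons, creation_apply_cons, corrAction, Adjointable.diag_apply, map_mul,
      mul_assoc]
    rfl

/-- The relation `T_ξ a = T_{ξ a}`. -/
theorem creation_mul_fockAction (u : S → A →⋆ₙₐ[ℂ] A) (a : A) (ξ : Corr S A) :
    creation u ξ * fockAction u a = creation u (rmul ξ a) := by
  refine Adjointable.ext_apply fun f v => ?_
  rw [Adjointable.mul_apply]
  cases v with
  | nil => rw [creation_apply_nil, creation_apply_nil]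
  | cons s w =>
    rw [creation_apply_cons, creation_apply_cons, fockAction, Adjointable.diag_apply, rmul_apply,
      map_mul, mul_assoc]

/-- The Toeplitz-Pimsner algebra of `F_u` in its Fock realization: the C*-algebra of operators on
the Fock module generated by the left action of `A` and the creation operators. -/
def toeplitzPimsner (u : S → A →⋆ₙₐ[ℂ] A) : NonUnitalStarSubalgebra ℂ (Adjointable (List S) A) :=
  (NonUnitalStarAlgebra.adjoin ℂ
    (Set.range (fockAction u) ∪ Set.range (creation u))).topologicalClosure

/-- The closed two-sided ideal generated by a set. -/
def closedIdealSpan {R : Type*} [NonUnitalRing R] [TopologicalSpace R] (s : Set R) :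
    TwoSidedIdeal R :=
  sInf {I | IsClosed (I : Set R) ∧ s ⊆ I}

/-- The ideal of the Toeplitz-Pimsner algebra generated by its intersection with the compact
operators on the summand `F_u^{⊗ 0} = A` of the Fock module. -/
def pimsnerIdeal (u : S → A →⋆ₙₐ[ℂ] A) : TwoSidedIdeal (toeplitzPimsner u) :=
  closedIdealSpan {x | (x : Adjointable (List S) A) ∈ Adjointable.compactOn {([] : List S)}}

/-- The Cuntz-Pimsner algebra of `F_u`, the quotient of the Toeplitz-Pimsner algebra by the
ideal above. -/
def CuntzPimsner (u : S → A →⋆ₙₐ[ℂ] A) : Type _ := (pimsnerIdeal u).ringCon.Quotient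

instance (u : S → A →⋆ₙₐ[ℂ] A) : NonUnitalRing (CuntzPimsner u) :=
  inferInstanceAs (NonUnitalRing (pimsnerIdeal u).ringCon.Quotient)

/-- The quotient topology, which is the topology of the quotient C*-norm. -/
instance (u : S → A →⋆ₙₐ[ℂ] A) : TopologicalSpace (CuntzPimsner u) :=
  inferInstanceAs (TopologicalSpace (Quotient (pimsnerIdeal u).ringCon.toSetoid))

end Fock

/-- Simplicity, for C*-algebras: `B` is nonzero and has no closed two-sided ideals except `0` and
`B`. (Closed two-sided ideals of C*-algebras are automatically self-adjoint subspaces.) -/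
def IsTopSimple (B : Type*) [NonUnitalRing B] [TopologicalSpace B] : Prop :=
  Nontrivial B ∧ ∀ I : TwoSidedIdeal B, IsClosed (I : Set B) → I = ⊥ ∨ I = ⊤

/-- A `*`-endomorphism is non-degenerate if it sends an approximate unit to an approximate unit. -/
def IsNondegenerate {A : Type*} [NonUnitalCStarAlgebra A] (φ : A →⋆ₙₐ[ℂ] A) : Prop :=
  ∃ l : Filter A, l.IsApproximateUnit ∧ (l.map φ).IsApproximateUnit

end Pimsner

end

noncomputable section

namespace Pimsner

open StdModule Adjointable Filter

/-! ### Coordinate projections, tails of vectors, sums of orthogonal operators -/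

section Operators

variable {X A : Type*} [NonUnitalCStarAlgebra A]

namespace StdModule

/-! On the Fock module `ℓ²(words) ⊗ A`, let `V_w` be the isometry that prepends the word `w`, let
`π` be the left action of `A`, and let `P_m` be the projection onto degree `m`. The relation `π(a)
V_w = V_w π(υ_w(a))` makes the span of the operators `V_p π(a) V_q*` a `*`-algebra whose closure
contains the Toeplitz–Pimsner algebra `T`. Elements of this span have finite propagation in degree.

The Pimsner ideal is exactly the set of `x ∈ T` that vanish at infinity (`mem_pimsnerIdeal_iff`).
These elements form a closed ideal containing the compact operators of degree zero. Conversely, if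
`x` vanishes at infinity, then `x` is the limit of its restrictions to degrees below `m`, and these
are generated by the degree-zero corner. Hence `π(a)` lies in the Pimsner ideal only for `a = 0`,
and the quotient is nonzero.

Simplicity reduces to the statement that a closed ideal `K` of `T` either lies in the Pimsner ideal
or equals `T` (`le_pimsnerIdeal_or_eq_top`). Suppose that `z ∈ K` does not vanish at infinity. By
finite propagation, `‖z P_m‖` stays above some `δ > 0` for arbitrarily large `m`
(`vanishesAtInfty_of_tendsto`), so some `f` of degree `m` has `‖z f‖ > δ ‖f‖`. As `|S| ≥ 2`, there
is a word `γ` for which the words `μγ`, with `μ` of length at most `m`, are pairwise incomparable.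
Compressing by `R = T_f V_γ` kills the terms that change the degree and gives `R* y R = π(υ_γ(⟨f, y
f⟩))` for `y` in the span with words of length at most `m`
(`star_tailCreation_mul_mul_tailCreation`). With `y` close to `z* z`, this places an element of `K`
closer to some `π(a)` than `‖a‖`.

Functional calculus then yields `π(h) ∈ K` with `h ≠ 0` (`exists_fockHom_mem_of_norm_sub_lt`). The
set of `a` with `π(a) ∈ K` is a closed ideal invariant under all `υ_s`, so it is `A`, and `K = T`.
The operators `V_w` are not known to lie in `T`; non-degeneracy supplies `V_w π(a)` instead, and
approximate units are inserted wherever a bare `V_w` would be wanted. -/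

theorem sum_apply {ι : Type*} (s : Finset ι) (f : ι → StdModule X A) (x : X) :
    (∑ i ∈ s, f i) x = ∑ i ∈ s, f i x :=
  map_sum (AddMonoidHom.mk' (fun f : StdModule X A => f x) fun _ _ => rfl) f s

theorem ip_sum_right {ι : Type*} (s : Finset ι) (f : StdModule X A) (g : ι → StdModule X A) :
    ip f (∑ i ∈ s, g i) = ∑ i ∈ s, ip f (g i) :=
  map_sum (AddMonoidHom.mk' (fun g : StdModule X A => ip f g) fun _ _ => ip_add_right _ _ _) g s

theorem ip_sum_left {ι : Type*} (s : Finset ι) (f : ι → StdModule X A) (g : StdModule X A) :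
    ip (∑ i ∈ s, f i) g = ∑ i ∈ s, ip (f i) g :=
  map_sum (AddMonoidHom.mk' (fun f : StdModule X A => ip f g) fun _ _ => ip_add_left _ _ _) f s

theorem ip_sub_right (f g h : StdModule X A) : ip f (g - h) = ip f g - ip f h :=
  map_sub (AddMonoidHom.mk' (fun g : StdModule X A => ip f g) fun _ _ => ip_add_right _ _ _) g h

open Classical in
/-- The element `δ_x ⊗ a`. -/
def single (x : X) (a : A) : StdModule X A :=
  ofFun (Pi.single x a) (summable_of_ne_finset_zero (s := {x}) fun y hy => by
    simp [Pi.single_eq_of_ne (show y ≠ x by simpa using hy)])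

@[simp] theorem single_apply_self (x : X) (a : A) : single x a x = a := by
  classical exact Pi.single_eq_same (M := fun _ => A) x a

theorem single_apply_of_ne {x y : X} (h : y ≠ x) (a : A) : single x a y = 0 := by
  classical exact Pi.single_eq_of_ne (M := fun _ => A) h a

theorem ip_single_left (x : X) (a : A) (f : StdModule X A) : ip (single x a) f = star a * f x := by
  rw [ip, tsum_eq_single x, single_apply_self]
  intro y hy
  rw [single_apply_of_ne hy, star_zero, zero_mul]

theorem eq_sum_single {f : StdModule X A} {s : Finset X} (h : ∀ x ∉ s, f x = 0) :
    f = ∑ x ∈ s, single x (f x) := by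
  ext y
  rw [sum_apply]
  by_cases hy : y ∈ s
  · rw [Finset.sum_eq_single_of_mem y hy fun x _ hx => single_apply_of_ne hx.symm _,
      single_apply_self]
  · rw [h y hy, Finset.sum_eq_zero]
    intro x hx
    exact single_apply_of_ne (by rintro rfl; exact hy hx) _

end StdModule

open StdModule

namespace Adjointable

theorem summable_indicator (Y : Set X) (f : StdModule X A) :
    Summable fun x => star (Y.indicator f x) * Y.indicator f x := by
  refine (f.2.indicator Y).congr fun x => ?_
  by_cases hx : x ∈ Y <;> simp [hx]

theorem norm_indicator_le (Y : Set X) (f : StdModule X A) :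
    ‖ofFun (Y.indicator f) (summable_indicator Y f)‖ ≤ 1 * ‖f‖ := by
  refine norm_le_of_ip_le (by positivity) ?_
  rw [one_mul, norm_sq]
  let _ := CStarAlgebra.spectralOrder A
  let _ := CStarAlgebra.spectralOrderedRing A
  refine CStarAlgebra.norm_le_norm_of_nonneg_of_le (ip_self_nonneg _) ?_
  refine hasSum_le (fun x => ?_) (hasSum_ip _ _) (hasSum_ip f f)
  change star (Y.indicator f x) * Y.indicator f x ≤ _
  by_cases hx : x ∈ Y
  · simp [hx]
  · simp [hx, star_mul_self_nonneg (f x)]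

/-- Restriction to `Y` as a bounded operator. -/
def restrictCLM (Y : Set X) : StdModule X A →L[ℂ] StdModule X A :=
  LinearMap.mkContinuous
    { toFun := fun f => ofFun (Y.indicator f) (summable_indicator Y f)
      map_add' := fun f g => StdModule.ext fun x => congrFun (Set.indicator_add Y f g) x
      map_smul' := fun c f => StdModule.ext fun x => congrFun (Set.indicator_const_smul Y c f) x }
    1 (norm_indicator_le Y)

theorem restrictCLM_isAdj (Y : Set X) :
    IsAdj (restrictCLM (A := A) Y) (restrictCLM Y) := by
  intro f g
  refine congrArg tsum (funext fun x => ?_)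
  change star (Y.indicator f x) * g x = star (f x) * Y.indicator g x
  by_cases hx : x ∈ Y <;> simp [hx]

/-- The projection of `ℓ²(X) ⊗ A` onto the summand `ℓ²(Y) ⊗ A`. -/
def restrict (Y : Set X) : Adjointable X A :=
  mk (restrictCLM Y) (restrictCLM Y) (restrictCLM_isAdj Y)

theorem restrict_apply (Y : Set X) (f : StdModule X A) (x : X) :
    (restrict Y).1 f x = Y.indicator f x := rfl

@[simp] theorem star_restrict (Y : Set X) : star (restrict Y : Adjointable X A) = restrict Y :=
  star_mk _ _ _

theorem norm_restrict_le (Y : Set X) : ‖(restrict Y : Adjointable X A)‖ ≤ 1 :=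
  LinearMap.mkContinuous_norm_le _ zero_le_one (norm_indicator_le Y)

theorem restrict_mul_restrict (Y Z : Set X) :
    (restrict Y * restrict Z : Adjointable X A) = restrict (Y ∩ Z) := by
  refine ext_apply fun f x => ?_
  rw [mul_apply, restrict_apply, restrict_apply]
  by_cases hY : x ∈ Y <;> by_cases hZ : x ∈ Z <;> simp [hY, hZ, restrict_apply]

theorem restrict_union {Y Z : Set X} (h : Disjoint Y Z) :
    (restrict (Y ∪ Z) : Adjointable X A) = restrict Y + restrict Z :=
  ext_apply fun f x => congrFun (Set.indicator_union_of_disjoint h f) x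

@[simp] theorem restrict_empty : (restrict ∅ : Adjointable X A) = 0 :=
  ext_apply fun f x => by rw [restrict_apply]; simp

@[simp] theorem restrict_univ : (restrict Set.univ : Adjointable X A) = 1 :=
  ext_apply fun f x => by rw [restrict_apply]; simp

theorem add_apply (T T' : Adjointable X A) (f : StdModule X A) (x : X) :
    (T + T').1 f x = T.1 f x + T'.1 f x := rfl

theorem sub_apply (T T' : Adjointable X A) (f : StdModule X A) (x : X) :
    (T - T').1 f x = T.1 f x - T'.1 f x := rfl

theorem norm_apply_le (T : Adjointable X A) (f : StdModule X A) : ‖T.1 f‖ ≤ ‖T‖ * ‖f‖ :=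
  T.1.le_opNorm f

theorem norm_le_of_forall (T : Adjointable X A) {C : ℝ} (hC : 0 ≤ C)
    (h : ∀ f, ‖T.1 f‖ ≤ C * ‖f‖) : ‖T‖ ≤ C :=
  T.1.opNorm_le_bound hC h

/-- The restrictions of a vector to the complements of finite sets are eventually small. -/
theorem exists_finset_norm_restrict_le (f : StdModule X A) {ε : ℝ} (hε : 0 < ε) :
    ∃ s : Finset X, ∀ Y : Set X, Disjoint Y s → ‖(restrict Y).1 f‖ ≤ ε := by
  obtain ⟨s, hs⟩ := summable_iff_vanishing_norm.1 f.2 (ε ^ 2) (by positivity)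
  refine ⟨s, fun Y hY => norm_le_of_ip_le hε.le ?_⟩
  have h := hasSum_ip ((restrict Y).1 f) ((restrict Y).1 f)
  refine le_of_tendsto h.norm (Eventually.of_forall fun t => ?_)
  classical
  have : ∑ x ∈ t, star ((restrict Y).1 f x) * (restrict Y).1 f x
      = ∑ x ∈ t with x ∈ Y, star (f x) * f x := by
    rw [Finset.sum_filter]
    refine Finset.sum_congr rfl fun x _ => ?_
    rw [restrict_apply]
    split_ifs with hx <;> simp [hx]
  rw [this]
  refine (hs _ (Finset.disjoint_left.2 fun x hx hxs => ?_)).le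
  exact Set.disjoint_left.1 hY (Finset.mem_filter.1 hx).2 hxs

/-- In a C*-ring, a sum of finitely many elements with orthogonal initial and orthogonal final
supports is bounded by any common bound of the summands. -/
theorem norm_sum_le_of_orthogonal {E ι : Type*} [NormedRing E] [StarRing E] [CStarRing E]
    (s : Finset ι) (T : ι → E) {C : ℝ} (hC : 0 ≤ C) (hT : ∀ i ∈ s, ‖T i‖ ≤ C)
    (h1 : ∀ i ∈ s, ∀ j ∈ s, i ≠ j → star (T i) * T j = 0)
    (h2 : ∀ i ∈ s, ∀ j ∈ s, i ≠ j → T i * star (T j) = 0) : ‖∑ i ∈ s, T i‖ ≤ C := by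
  set H : ι → E := fun i => star (T i) * T i with hH
  have hD : star (∑ i ∈ s, T i) * ∑ i ∈ s, T i = ∑ i ∈ s, H i := by
    rw [star_sum, Finset.sum_mul]
    refine Finset.sum_congr rfl fun i hi => ?_
    rw [Finset.mul_sum, Finset.sum_eq_single_of_mem i hi fun j hj hij => h1 i hi j hj hij.symm]
  -- Orthogonality on the other side gives `H i * H j = 0` for `i ≠ j`, so powers of the sum have no
  -- cross terms.
  have hpow (n : ℕ) : (∑ i ∈ s, H i) ^ (n + 1) = ∑ i ∈ s, H i ^ (n + 1) := by
    induction n with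
    | zero => simp
    | succ n ih =>
      rw [pow_succ, ih, Finset.sum_mul]
      refine Finset.sum_congr rfl fun i hi => ?_
      rw [Finset.mul_sum, Finset.sum_eq_single_of_mem i hi, ← pow_succ]
      intro j hj hij
      rw [pow_succ, mul_assoc, hH]
      dsimp only
      rw [mul_assoc (star (T i)), ← mul_assoc (T i) (star (T j)), h2 i hi j hj hij.symm]
      simp
  have hsa : IsSelfAdjoint (∑ i ∈ s, H i) := hD ▸ IsSelfAdjoint.star_mul_self _
  -- The triangle inequality costs a factor `s.card`, but it does so after passing to the power `2 ^
  -- n`. The factor disappears as `n` grows.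
  have key (n : ℕ) : (‖∑ i ∈ s, T i‖ ^ 2) ^ (2 ^ n) ≤ s.card * (C ^ 2) ^ (2 ^ n) := by
    have e : ‖∑ i ∈ s, T i‖ ^ 2 = ‖∑ i ∈ s, H i‖ := by
      rw [← hD, CStarRing.norm_star_mul_self, sq]
    rw [e, ← hsa.norm_pow_two_pow]
    obtain ⟨m, hm⟩ : ∃ m, 2 ^ n = m + 1 := ⟨2 ^ n - 1, (Nat.sub_add_cancel Nat.one_le_two_pow).symm⟩
    rw [hm, hpow, ← nsmul_eq_mul]
    refine (norm_sum_le _ _).trans (Finset.sum_le_card_nsmul _ _ _ fun i hi => ?_)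
    refine (norm_pow_le' _ (Nat.succ_pos _)).trans ?_
    gcongr
    rw [hH, CStarRing.norm_star_mul_self, ← sq]
    gcongr
    exact hT i hi
  by_contra! hlt
  have hpos : 0 < ‖∑ i ∈ s, T i‖ := hC.trans_lt hlt
  rcases hC.eq_or_lt with rfl | hC0
  · have := key 0
    simp at this
    rw [this] at hpos
    simp at hpos
  have hr : 1 < ‖∑ i ∈ s, T i‖ ^ 2 / C ^ 2 := by
    rw [one_lt_div (by positivity)]
    gcongr
  obtain ⟨n, hn⟩ := pow_unbounded_of_one_lt (s.card : ℝ) hr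
  have h3 := key n
  rw [← div_le_iff₀ (by positivity), ← div_pow] at h3
  exact absurd (hn.trans_le (pow_le_pow_right₀ hr.le Nat.lt_two_pow_self.le)) (not_lt.2 h3)

end Adjointable

end Operators

/-! ### Norm estimates for diagonal operators and coordinates -/

section Diagonal

variable {X A : Type*} [NonUnitalCStarAlgebra A]

/-- The continuity constant built into `diag` is an arbitrary choice from `hc`. Here any common
bound of the family serves, which makes `π` contractive. -/
theorem Adjointable.norm_diag_le (c : X → A) (hc : ∃ C : ℝ, ∀ x, ‖c x‖ ≤ C) {C : ℝ} (hC0 : 0 ≤ C)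
    (hC : ∀ x, ‖c x‖ ≤ C) : ‖diag c hc‖ ≤ C := by
  let _ := CStarAlgebra.spectralOrder A
  let _ := CStarAlgebra.spectralOrderedRing A
  refine norm_le_of_forall _ hC0 fun f => norm_le_of_ip_le (by positivity) ?_
  have hle (x : X) : star (c x * f x) * (c x * f x) ≤ (C ^ 2) • (star (f x) * f x) := by
    have h1 := CStarAlgebra.star_left_conjugate_le_norm_smul (a := f x) (b := star (c x) * c x)
      (IsSelfAdjoint.star_mul_self _)
    have h2 : ‖star (c x) * c x‖ ≤ C ^ 2 := by
      rw [CStarRing.norm_star_mul_self, ← sq]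
      exact pow_le_pow_left₀ (norm_nonneg _) (hC x) 2
    have h3 := smul_le_smul_of_nonneg_right h2 (star_mul_self_nonneg (f x))
    simpa [mul_assoc] using h1.trans h3
  have h1 : ip ((diag c hc).1 f) ((diag c hc).1 f) ≤ (C ^ 2) • ip f f :=
    hasSum_le hle (hasSum_ip _ _) ((hasSum_ip f f).const_smul (C ^ 2))
  calc _ ≤ ‖(C ^ 2) • ip f f‖ :=
        CStarAlgebra.norm_le_norm_of_nonneg_of_le (ip_self_nonneg _) h1
    _ = (C * ‖f‖) ^ 2 := by rw [norm_smul, mul_pow, norm_sq]; simp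

theorem Adjointable.norm_apply_le_norm (f : StdModule X A) (x : X) : ‖f x‖ ≤ ‖f‖ := by
  let _ := CStarAlgebra.spectralOrder A
  let _ := CStarAlgebra.spectralOrderedRing A
  have h : ‖star (f x) * f x‖ ≤ ‖ip f f‖ :=
    CStarAlgebra.norm_le_norm_of_nonneg_of_le (star_mul_self_nonneg _)
      (le_hasSum (hasSum_ip f f) x fun y _ => star_mul_self_nonneg _)
  rw [CStarRing.norm_star_mul_self, ← norm_sq, ← sq] at h
  exact (abs_le_of_sq_le_sq' h (norm_nonneg _)).2

theorem norm_single (x : X) (a : A) : ‖single x a‖ = ‖a‖ := by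
  rw [norm_def, ip_single_left, single_apply_self, CStarRing.norm_star_mul_self,
    Real.sqrt_mul_self (norm_nonneg _)]

end Diagonal

/-! ### Word isometries and the `*`-algebra spanned by `V_p π(a) V_q*` -/

section Words

variable {S A : Type*} [NonUnitalCStarAlgebra A]

/-- The isometry `δ_v ⊗ b ↦ δ_{w v} ⊗ b`. -/
def wordShift (w : List S) : Adjointable (List S) A :=
  shift (fun v => w ++ v) (List.append_right_injective w)

theorem wordShift_apply_append (w v : List S) (f : Fock S A) :
    (wordShift w).1 f (w ++ v) = f v := by
  rw [wordShift, shift_apply]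
  exact (List.append_right_injective w).extend_apply _ _ _

theorem wordShift_apply_of_not_prefix {w v : List S} (h : ¬ w <+: v) (f : Fock S A) :
    (wordShift w).1 f v = 0 := by
  rw [wordShift, shift_apply, Function.extend_apply']
  · rfl
  · rintro ⟨a, rfl⟩
    exact h (List.prefix_append _ _)

theorem star_wordShift_apply (w v : List S) (f : Fock S A) :
    (star (wordShift w)).1 f v = f (w ++ v) := star_shift_apply _ _ _ _

theorem wordShift_mul_wordShift (w v : List S) :
    (wordShift w * wordShift v : Adjointable (List S) A) = wordShift (w ++ v) := by
  refine ext_apply fun f x => ?_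
  rw [mul_apply]
  by_cases hx : w <+: x
  · obtain ⟨y, rfl⟩ := hx
    rw [wordShift_apply_append]
    by_cases hy : v <+: y
    · obtain ⟨z, rfl⟩ := hy
      rw [wordShift_apply_append, ← List.append_assoc, wordShift_apply_append]
    · rw [wordShift_apply_of_not_prefix hy, wordShift_apply_of_not_prefix]
      rwa [List.prefix_append_right_inj]
  · rw [wordShift_apply_of_not_prefix hx, wordShift_apply_of_not_prefix]
    exact fun h => hx ((List.prefix_append _ _).trans h)

@[simp] theorem wordShift_nil : (wordShift [] : Adjointable (List S) A) = 1 :=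
  ext_apply fun f x => wordShift_apply_append [] x f

theorem star_wordShift_mul_self (w : List S) :
    (star (wordShift w) * wordShift w : Adjointable (List S) A) = 1 :=
  ext_apply fun f x => by
    rw [mul_apply, star_wordShift_apply, wordShift_apply_append]; rfl

theorem star_wordShift_mul_append (w v : List S) :
    (star (wordShift w) * wordShift (w ++ v) : Adjointable (List S) A) = wordShift v := by
  rw [← wordShift_mul_wordShift, ← mul_assoc, star_wordShift_mul_self, one_mul]

theorem star_wordShift_append_mul (w v : List S) :
    (star (wordShift (w ++ v)) * wordShift w : Adjointable (List S) A) = star (wordShift v) := by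
  rw [← star_wordShift_mul_append w v, star_mul, star_star]

theorem star_wordShift_mul_of_incomparable {w v : List S} (h1 : ¬ w <+: v) (h2 : ¬ v <+: w) :
    (star (wordShift w) * wordShift v : Adjointable (List S) A) = 0 := by
  refine ext_apply fun f x => ?_
  rw [mul_apply, star_wordShift_apply, wordShift_apply_of_not_prefix]
  · rfl
  · intro h
    exact (List.prefix_or_prefix_of_prefix h (List.prefix_append w x)).elim h2 h1

variable (u : S → A →⋆ₙₐ[ℂ] A)

theorem wordHom_append (w v : List S) (a : A) :
    wordHom u (w ++ v) a = wordHom u v (wordHom u w a) := by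
  induction w generalizing a with
  | nil => rfl
  | cons s w ih => exact ih (u s a)

theorem wordHom_injective (hinj : ∀ s, Function.Injective (u s)) (w : List S) :
    Function.Injective (wordHom u w) := by
  induction w with
  | nil => exact fun _ _ h => h
  | cons s w ih => exact ih.comp (hinj s)

theorem norm_wordHom (hinj : ∀ s, Function.Injective (u s)) (w : List S) (a : A) :
    ‖wordHom u w a‖ = ‖a‖ :=
  NonUnitalStarAlgHom.norm_map (wordHom u w) (wordHom_injective u hinj w) a

theorem fockAction_apply (a : A) (f : Fock S A) (w : List S) :
    (fockAction u a).1 f w = wordHom u w a * f w := rfl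

/-- The left action of `A` on the Fock module as a `*`-homomorphism. -/
def fockHom : A →⋆ₙₐ[ℂ] Adjointable (List S) A where
  toFun := fockAction u
  map_smul' c a := ext_apply fun f w => by
    rw [fockAction_apply, map_smul, smul_mul_assoc]; rfl
  map_zero' := ext_apply fun f w => by
    rw [fockAction_apply, map_zero, zero_mul]; rfl
  map_add' a b := ext_apply fun f w => by
    rw [Adjointable.add_apply, fockAction_apply, fockAction_apply, fockAction_apply, map_add, add_mul]
  map_mul' a b := ext_apply fun f w => by
    rw [mul_apply, fockAction_apply, fockAction_apply, fockAction_apply, map_mul, mul_assoc]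
  map_star' a := ext_apply fun f w => by
    rw [fockAction_apply, map_star, fockAction, star_diag_apply]

theorem fockHom_apply (a : A) (f : Fock S A) (w : List S) :
    (fockHom u a).1 f w = wordHom u w a * f w := rfl

theorem norm_fockHom_le (a : A) : ‖fockHom u a‖ ≤ ‖a‖ :=
  norm_diag_le _ _ (norm_nonneg _) fun w => NonUnitalStarAlgHom.norm_apply_le (wordHom u w) a

theorem continuous_fockHom : Continuous (fockHom u) :=
  (AddMonoidHomClass.lipschitz_of_bound (fockHom u) 1 fun a => by
    simpa using norm_fockHom_le u a).continuous

/-- The covariance relation behind all later products: both sides see the value `υ_{wx}(a) =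
υ_x(υ_w(a))` at the word `wx`. -/
theorem fockHom_mul_wordShift (a : A) (w : List S) :
    fockHom u a * wordShift w = wordShift w * fockHom u (wordHom u w a) := by
  refine ext_apply fun f v => ?_
  rw [mul_apply, mul_apply, fockHom_apply]
  by_cases h : w <+: v
  · obtain ⟨x, rfl⟩ := h
    rw [wordShift_apply_append, wordShift_apply_append, wordHom_append, fockHom_apply]
  · rw [wordShift_apply_of_not_prefix h, wordShift_apply_of_not_prefix h, mul_zero]

theorem star_wordShift_mul_fockHom (a : A) (w : List S) :
    star (wordShift w) * fockHom u a = fockHom u (wordHom u w a) * star (wordShift w) := by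
  have h := congrArg star (fockHom_mul_wordShift u (star a) w)
  rw [star_mul, star_mul, ← map_star, ← map_star, ← map_star, star_star] at h
  exact h

/-- The operator `V_p π(a) V_q^*` on the Fock module. -/
def matUnit (p : List S) (a : A) (q : List S) : Adjointable (List S) A :=
  wordShift p * fockHom u a * star (wordShift q)

theorem star_matUnit (p : List S) (a : A) (q : List S) :
    star (matUnit u p a q) = matUnit u q (star a) p := by
  rw [matUnit, matUnit, star_mul, star_mul, star_star, map_star, mul_assoc]

/-- Since `V_q* V_{qr} = V_r`, covariance moves `V_r` to the left of `π(a)`. With its adjoint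
version and the incomparable case this shows that the span is closed under products. -/
theorem matUnit_mul_matUnit_append (p : List S) (a : A) (q r : List S) (b : A) (t : List S) :
    matUnit u p a q * matUnit u (q ++ r) b t = matUnit u (p ++ r) (wordHom u r a * b) t := by
  calc _ = wordShift p * fockHom u a * (star (wordShift q) * wordShift (q ++ r)) * fockHom u b
        * star (wordShift t) := by simp only [matUnit, mul_assoc]
    _ = wordShift p * (fockHom u a * wordShift r) * fockHom u b * star (wordShift t) := by
        rw [star_wordShift_mul_append]; simp only [mul_assoc]
    _ = _ := by
        rw [fockHom_mul_wordShift, matUnit, map_mul, ← wordShift_mul_wordShift]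
        simp only [mul_assoc]

theorem matUnit_append_mul_matUnit (p : List S) (a : A) (q r : List S) (b : A) (t : List S) :
    matUnit u p a (q ++ r) * matUnit u q b t = matUnit u p (a * wordHom u r b) (t ++ r) := by
  have h := congrArg star (matUnit_mul_matUnit_append u t (star b) q r (star a) p)
  rw [star_mul, star_matUnit, star_matUnit, star_matUnit, star_mul, star_star, star_star, map_star,
    star_star] at h
  exact h

theorem matUnit_mul_matUnit_of_incomparable (p : List S) (a : A) {q r : List S} (b : A)
    (t : List S) (h1 : ¬ q <+: r) (h2 : ¬ r <+: q) : matUnit u p a q * matUnit u r b t = 0 := by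
  calc _ = wordShift p * fockHom u a * (star (wordShift q) * wordShift r) * (fockHom u b
        * star (wordShift t)) := by simp only [matUnit, mul_assoc]
    _ = 0 := by rw [star_wordShift_mul_of_incomparable h1 h2]; simp

theorem matUnit_apply_append (p : List S) (a : A) (q v : List S) (f : Fock S A) :
    (matUnit u p a q).1 f (p ++ v) = wordHom u v a * f (q ++ v) := by
  rw [matUnit, mul_apply, mul_apply, wordShift_apply_append, fockHom_apply, star_wordShift_apply]

theorem matUnit_apply_of_not_prefix {p v : List S} (h : ¬ p <+: v) (a : A) (q : List S)
    (f : Fock S A) : (matUnit u p a q).1 f v = 0 := by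
  rw [matUnit, mul_apply, mul_apply, wordShift_apply_of_not_prefix h]

theorem matUnit_nil_nil (a : A) : matUnit u [] a [] = fockHom u a := by
  simp [matUnit]

theorem continuous_matUnit (p q : List S) : Continuous fun a => matUnit u p a q := by
  have := continuous_fockHom u
  unfold matUnit
  fun_prop

theorem matUnit_smul (p q : List S) (c : ℂ) (a : A) :
    matUnit u p (c • a) q = c • matUnit u p a q := by
  simp [matUnit]

/-- The linear span of the operators `V_p π(a) V_q^*` with `p`, `q` of length at most `k`. -/
def finSpan (k : ℕ) : Submodule ℂ (Adjointable (List S) A) :=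
  Submodule.span ℂ {T | ∃ p a q, p.length ≤ k ∧ q.length ≤ k ∧ T = matUnit u p a q}

theorem finSpan_mono {k l : ℕ} (h : k ≤ l) : finSpan u k ≤ finSpan u l :=
  Submodule.span_mono fun _ ⟨p, a, q, hp, hq, e⟩ => ⟨p, a, q, hp.trans h, hq.trans h, e⟩

/-- The linear span of the operators `V_p π(a) V_q^*`. -/
def wordSpan : Submodule ℂ (Adjointable (List S) A) :=
  Submodule.span ℂ {T | ∃ p a q, T = matUnit u p a q}

theorem matUnit_mem_wordSpan (p : List S) (a : A) (q : List S) : matUnit u p a q ∈ wordSpan u :=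
  Submodule.subset_span ⟨p, a, q, rfl⟩

theorem exists_mem_finSpan {x : Adjointable (List S) A} (hx : x ∈ wordSpan u) :
    ∃ k, x ∈ finSpan u k := by
  induction hx using Submodule.span_induction with
  | mem x h =>
    obtain ⟨p, a, q, rfl⟩ := h
    exact ⟨max p.length q.length,
      Submodule.subset_span ⟨p, a, q, le_max_left _ _, le_max_right _ _, rfl⟩⟩
  | zero => exact ⟨0, zero_mem _⟩
  | add x y _ _ hx hy =>
    obtain ⟨k, hk⟩ := hx
    obtain ⟨l, hl⟩ := hy
    exact ⟨max k l, add_mem (finSpan_mono u (le_max_left _ _) hk)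
      (finSpan_mono u (le_max_right _ _) hl)⟩
  | smul c x _ hx =>
    obtain ⟨k, hk⟩ := hx
    exact ⟨k, Submodule.smul_mem _ _ hk⟩

theorem matUnit_mul_matUnit_mem (p : List S) (a : A) (q r : List S) (b : A) (t : List S) :
    matUnit u p a q * matUnit u r b t ∈ wordSpan u := by
  by_cases h1 : q <+: r
  · obtain ⟨v, rfl⟩ := h1
    rw [matUnit_mul_matUnit_append]
    exact matUnit_mem_wordSpan u _ _ _
  by_cases h2 : r <+: q
  · obtain ⟨v, rfl⟩ := h2
    rw [matUnit_append_mul_matUnit]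
    exact matUnit_mem_wordSpan u _ _ _
  rw [matUnit_mul_matUnit_of_incomparable u p a b t h1 h2]
  exact zero_mem _

theorem mul_mem_wordSpan {x y : Adjointable (List S) A} (hx : x ∈ wordSpan u)
    (hy : y ∈ wordSpan u) : x * y ∈ wordSpan u := by
  induction hx using Submodule.span_induction with
  | zero => simp
  | add x x' _ _ hx hx' => rw [add_mul]; exact add_mem hx hx'
  | smul c x _ hx => rw [smul_mul_assoc]; exact Submodule.smul_mem _ _ hx
  | mem x h =>
    obtain ⟨p, a, q, rfl⟩ := h
    induction hy using Submodule.span_induction with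
    | zero => simp
    | add y y' _ _ hy hy' => rw [mul_add]; exact add_mem hy hy'
    | smul c y _ hy => rw [mul_smul_comm]; exact Submodule.smul_mem _ _ hy
    | mem y h =>
      obtain ⟨r, b, t, rfl⟩ := h
      exact matUnit_mul_matUnit_mem u p a q r b t

theorem star_mem_wordSpan {x : Adjointable (List S) A} (hx : x ∈ wordSpan u) :
    star x ∈ wordSpan u := by
  induction hx using Submodule.span_induction with
  | zero => simp
  | add x x' _ _ hx hx' => rw [star_add]; exact add_mem hx hx'
  | smul c x _ hx => rw [star_smul]; exact Submodule.smul_mem _ _ hx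
  | mem x h =>
    obtain ⟨p, a, q, rfl⟩ := h
    rw [star_matUnit]
    exact matUnit_mem_wordSpan u _ _ _

/-- The span of the operators `V_p π(a) V_q^*` as a `*`-algebra. -/
def wordAlgebra : NonUnitalStarSubalgebra ℂ (Adjointable (List S) A) where
  __ := wordSpan u
  mul_mem' := mul_mem_wordSpan u
  star_mem' := star_mem_wordSpan u

end Words

/-! ### The Toeplitz–Pimsner algebra and its elements `V_w π(a)` -/

section Toeplitz

variable {S A : Type*} [NonUnitalCStarAlgebra A] [Fintype S] (u : S → A →⋆ₙₐ[ℂ] A)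

theorem creation_eq_sum (ξ : Corr S A) :
    creation u ξ = ∑ s, matUnit u [s] (ξ s) [] := by
  simp only [matUnit, wordShift_nil, star_one, mul_one]
  rfl

/-- The generators already lie in the `*`-algebra of words. This supplies approximants of finite
propagation. -/
theorem toeplitzPimsner_le : toeplitzPimsner u ≤ (wordAlgebra u).topologicalClosure := by
  refine NonUnitalStarSubalgebra.topologicalClosure_mono (NonUnitalStarAlgebra.adjoin_le ?_)
  rintro _ (⟨a, rfl⟩ | ⟨ξ, rfl⟩)
  · change fockHom u a ∈ wordSpan u
    rw [← matUnit_nil_nil]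
    exact matUnit_mem_wordSpan u _ _ _
  · change creation u ξ ∈ wordSpan u
    rw [creation_eq_sum]
    exact sum_mem fun s _ => matUnit_mem_wordSpan u _ _ _

theorem exists_finSpan_norm_sub_lt {x : Adjointable (List S) A} (hx : x ∈ toeplitzPimsner u)
    {ε : ℝ} (hε : 0 < ε) : ∃ k, ∃ y ∈ finSpan u k, ‖x - y‖ < ε := by
  obtain ⟨y, hy, hxy⟩ := Metric.mem_closure_iff.1 (toeplitzPimsner_le u hx) ε hε
  obtain ⟨k, hk⟩ := exists_mem_finSpan u hy
  exact ⟨k, y, hk, by rwa [← dist_eq_norm]⟩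

theorem isClosed_toeplitzPimsner :
    IsClosed (toeplitzPimsner u : Set (Adjointable (List S) A)) :=
  NonUnitalStarSubalgebra.isClosed_topologicalClosure _

theorem fockHom_mem (a : A) : fockHom u a ∈ toeplitzPimsner u :=
  NonUnitalStarSubalgebra.le_topologicalClosure _
    (NonUnitalStarAlgebra.subset_adjoin _ _ (.inl ⟨a, rfl⟩))

theorem creation_mem (ξ : Corr S A) : creation u ξ ∈ toeplitzPimsner u :=
  NonUnitalStarSubalgebra.le_topologicalClosure _
    (NonUnitalStarAlgebra.subset_adjoin _ _ (.inr ⟨ξ, rfl⟩))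

theorem wordShift_singleton_mul_fockHom_mem (s : S) (a : A) :
    wordShift [s] * fockHom u a ∈ toeplitzPimsner u := by
  have h := creation_mem u (single s a)
  rw [creation_eq_sum, Finset.sum_eq_single s] at h
  · simpa [matUnit] using h
  · intro t _ ht
    rw [single_apply_of_ne ht]
    simp [matUnit]
  · simp

variable {u}

/-- Here non-degeneracy enters: `V_w π(e) · V_s π(a) = V_{ws} π(υ_s(e) a)`, and `υ_s(e) a → a` along
an approximate unit adapted to `s`. The induction removes the last letter because that is the letter
whose endomorphism acts on `e`. -/
theorem wordShift_mul_fockHom_mem (hnd : ∀ s, IsNondegenerate (u s)) (w : List S) (a : A) :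
    wordShift w * fockHom u a ∈ toeplitzPimsner u := by
  induction w using List.reverseRecOn generalizing a with
  | nil => simpa using fockHom_mem u a
  | append_singleton w s ih =>
    obtain ⟨l, hl, hl'⟩ := hnd s
    have := hl.neBot
    have h1 : Tendsto (fun e => u s e * a) l (𝓝 a) :=
      (hl'.tendsto_mul_right a).comp tendsto_map
    have h2 : Tendsto (fun e => wordShift (w ++ [s]) * fockHom u (u s e * a)) l
        (𝓝 (wordShift (w ++ [s]) * fockHom u a)) :=
      (((continuous_fockHom u).tendsto a).comp h1).const_mul _
    refine (isClosed_toeplitzPimsner u).mem_of_tendsto h2 (Eventually.of_forall fun e => ?_)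
    have h3 : wordShift (w ++ [s]) * fockHom u (u s e * a)
        = wordShift w * fockHom u e * (wordShift [s] * fockHom u a) := by
      rw [mul_assoc, ← mul_assoc (fockHom u e), fockHom_mul_wordShift, map_mul,
        ← wordShift_mul_wordShift]
      simp only [mul_assoc]
      rfl
    rw [h3]
    exact mul_mem (ih e) (wordShift_singleton_mul_fockHom_mem u s a)

end Toeplitz

/-! ### Degree projections, finite propagation, vanishing at infinity -/

section Levels

variable {S A : Type*} [NonUnitalCStarAlgebra A]

/-- The projection of the Fock module onto the summands whose degree lies in `Y`. -/
def levels (Y : Set ℕ) : Adjointable (List S) A := restrict {w | w.length ∈ Y}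

theorem levels_mul_levels (Y Z : Set ℕ) :
    (levels Y * levels Z : Adjointable (List S) A) = levels (Y ∩ Z) :=
  restrict_mul_restrict _ _

theorem levels_union {Y Z : Set ℕ} (h : Disjoint Y Z) :
    (levels (Y ∪ Z) : Adjointable (List S) A) = levels Y + levels Z :=
  restrict_union (Set.disjoint_left.2 fun _ hw hw' => Set.disjoint_left.1 h hw hw')

@[simp] theorem star_levels (Y : Set ℕ) :
    star (levels Y : Adjointable (List S) A) = levels Y := star_restrict _

theorem norm_levels_le (Y : Set ℕ) : ‖(levels Y : Adjointable (List S) A)‖ ≤ 1 :=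
  norm_restrict_le _

theorem norm_mul_levels_le (x : Adjointable (List S) A) (Y : Set ℕ) : ‖x * levels Y‖ ≤ ‖x‖ :=
  (norm_mul_le _ _).trans (mul_le_of_le_one_right (norm_nonneg _) (norm_levels_le Y))

@[simp] theorem levels_empty : (levels ∅ : Adjointable (List S) A) = 0 := restrict_empty

@[simp] theorem levels_univ : (levels Set.univ : Adjointable (List S) A) = 1 := restrict_univ

theorem levels_add_compl (Y : Set ℕ) : (levels Y + levels Yᶜ : Adjointable (List S) A) = 1 := by
  rw [← levels_union disjoint_compl_right, Set.union_compl_self, levels_univ]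

theorem levels_mul_of_disjoint {Y Z : Set ℕ} (h : Disjoint Y Z) :
    (levels Y * levels Z : Adjointable (List S) A) = 0 := by
  rw [levels_mul_levels, h.inter_eq, levels_empty]

theorem norm_mul_levels_mono (x : Adjointable (List S) A) {Y Z : Set ℕ} (h : Y ⊆ Z) :
    ‖x * levels Y‖ ≤ ‖x * levels Z‖ := by
  have : (levels Y : Adjointable (List S) A) = levels Z * levels Y := by
    rw [levels_mul_levels, Set.inter_eq_right.2 h]
  rw [this, ← mul_assoc]
  exact norm_mul_levels_le _ _

theorem levels_Ico_add (a b c : ℕ) :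
    (levels (Set.Ico a (a + b + c)) : Adjointable (List S) A)
      = levels (Set.Ico a (a + b)) + levels (Set.Ico (a + b) (a + b + c)) := by
  rw [← levels_union, Set.Ico_union_Ico_eq_Ico] <;> simp

theorem levels_Ico_eq_sum (a L : ℕ) :
    (levels (Set.Ico a (a + L)) : Adjointable (List S) A)
      = ∑ j ∈ Finset.range L, levels {a + j} := by
  induction L with
  | zero => simp
  | succ L ih =>
    rw [Finset.sum_range_succ, ← ih, ← add_assoc, levels_Ico_add]
    congr 2
    ext n
    simp
    omega

theorem levels_Ico_eq_sum_windows (m L N : ℕ) :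
    (levels (Set.Ico m (m + N * (2 * L))) : Adjointable (List S) A)
      = ∑ i ∈ Finset.range N, levels (Set.Ico (m + i * (2 * L)) (m + i * (2 * L) + L))
        + ∑ i ∈ Finset.range N, levels (Set.Ico (m + L + i * (2 * L)) (m + L + i * (2 * L) + L)) := by
  induction N with
  | zero => simp
  | succ N ih =>
    rw [Finset.sum_range_succ, Finset.sum_range_succ, add_add_add_comm, ← ih,
      show m + (N + 1) * (2 * L) = m + N * (2 * L) + 2 * L by ring, levels_Ico_add,
      show m + N * (2 * L) + 2 * L = m + N * (2 * L) + L + L by ring, levels_Ico_add,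
      show m + N * (2 * L) + L = m + L + N * (2 * L) by ring]

/-- A fixed vector has little mass in high degrees, so bounds on arbitrarily long finite bands of
degrees pass to the infinite band. -/
theorem norm_mul_levels_Ici_le (x : Adjointable (List S) A) (m : ℕ) {C : ℝ} (hC : 0 ≤ C)
    (h : ∀ M, ∃ M' ≥ M, ‖x * levels (Set.Ico m M')‖ ≤ C) : ‖x * levels (Set.Ici m)‖ ≤ C := by
  refine norm_le_of_forall _ hC fun f => le_of_forall_pos_le_add fun ε hε => ?_
  obtain ⟨s, hs⟩ := exists_finset_norm_restrict_le f (ε := ε / (‖x‖ + 1)) (by positivity)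
  obtain ⟨M, hM, hxM⟩ := h (max m (s.sup List.length + 1))
  have hd : (levels (Set.Ici m) : Adjointable (List S) A)
      = levels (Set.Ico m M) + levels (Set.Ici M) := by
    rw [← levels_union, Set.Ico_union_Ici_eq_Ici ((le_max_left _ _).trans hM)]
    exact Set.disjoint_left.2 fun n hn hn' => absurd hn.2 (not_lt.2 hn')
  have h1 : ‖(levels (Set.Ici M)).1 f‖ ≤ ε / (‖x‖ + 1) := by
    refine hs _ (Set.disjoint_left.2 fun w hw hws => ?_)
    have h2 : w.length ≤ s.sup List.length := Finset.le_sup (f := List.length) hws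
    have h3 := (le_max_right _ _).trans hM
    have h4 : M ≤ w.length := hw
    omega
  have h2 : (x * levels (Set.Ici m)).1 f
      = (x * levels (Set.Ico m M)).1 f + x.1 ((levels (Set.Ici M)).1 f) := by
    rw [hd, mul_add]; rfl
  rw [h2]
  refine (norm_add_le _ _).trans (add_le_add ((norm_apply_le _ _).trans (by gcongr)) ?_)
  calc _ ≤ ‖x‖ * (ε / (‖x‖ + 1)) := (norm_apply_le _ _).trans (by gcongr)
    _ = ‖x‖ / (‖x‖ + 1) * ε := by ring
    _ ≤ 1 * ε := by
      gcongr
      rw [div_le_one (by positivity)]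
      linarith
    _ = ε := one_mul _

variable (u : S → A →⋆ₙₐ[ℂ] A)

/-- `V_p π(a) V_q*` removes the prefix `q` and adds the prefix `p`, so it shifts degrees by exactly
`|p| - |q|`. -/
theorem levels_mul_matUnit_mul_levels (p : List S) (a : A) (q : List S) {Y Z : Set ℕ}
    (h : ∀ i ∈ Y, ∀ j ∈ Z, i + q.length ≠ j + p.length) :
    levels Y * matUnit u p a q * levels Z = 0 := by
  refine ext_apply fun f w => ?_
  change {w : List S | w.length ∈ Y}.indicator
    ((matUnit u p a q).1 ((levels Z).1 f)) w = 0
  by_cases hw : w.length ∈ Y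
  · rw [Set.indicator_of_mem (by exact hw)]
    by_cases hp : p <+: w
    · obtain ⟨v, rfl⟩ := hp
      rw [matUnit_apply_append, levels, restrict_apply, Set.indicator_of_notMem, mul_zero]
      · intro hv
        refine h _ hw _ hv ?_
        simp only [List.length_append]
        omega
    · rw [matUnit_apply_of_not_prefix u hp]
  · rw [Set.indicator_of_notMem (by exact hw)]

theorem levels_mul_mul_levels {k : ℕ} {y : Adjointable (List S) A} (hy : y ∈ finSpan u k)
    {Y Z : Set ℕ} (h : ∀ i ∈ Y, ∀ j ∈ Z, i + k < j ∨ j + k < i) :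
    levels Y * y * levels Z = 0 := by
  induction hy using Submodule.span_induction with
  | zero => simp
  | add x y _ _ hx hy => rw [mul_add, add_mul, hx, hy, add_zero]
  | smul c x _ hx => rw [mul_smul_comm, smul_mul_assoc, hx, smul_zero]
  | mem x hx =>
    obtain ⟨p, a, q, hp, hq, rfl⟩ := hx
    refine levels_mul_matUnit_mul_levels u p a q fun i hi j hj => ?_
    have := h i hi j hj
    omega

theorem levels_mul_star_mul_levels {k : ℕ} {y : Adjointable (List S) A} (hy : y ∈ finSpan u k)
    {Y Z : Set ℕ} (h : ∀ i ∈ Y, ∀ j ∈ Z, i + 2 * k < j ∨ j + 2 * k < i) :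
    levels Y * star y * (y * levels Z) = 0 := by
  -- The `k`-neighbourhood of `Y`: it receives everything that `y` produces from degrees in `Y`, and
  -- its distance from `Z` still exceeds `k`.
  set N : Set ℕ := {n | ∃ i ∈ Y, n ≤ i + k ∧ i ≤ n + k}
  have h1 : levels N * y * levels Z = 0 := by
    refine levels_mul_mul_levels u hy fun n ⟨i, hi, h1, h2⟩ j hj => ?_
    have := h i hi j hj
    omega
  have h2 : levels Y * star y * levels Nᶜ = 0 := by
    have h3 : levels Nᶜ * y * levels Y = 0 := by
      refine levels_mul_mul_levels u hy fun n hn i hi => ?_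
      by_contra! hc
      exact hn ⟨i, hi, hc.2, hc.1⟩
    simpa [mul_assoc] using congrArg star h3
  calc levels Y * star y * (y * levels Z)
      = levels Y * star y * ((levels N + levels Nᶜ) * (y * levels Z)) := by
        rw [levels_add_compl, one_mul]
    _ = levels Y * star y * (levels N * y * levels Z)
        + levels Y * star y * levels Nᶜ * (y * levels Z) := by
        rw [add_mul, mul_add]; simp only [mul_assoc]
    _ = 0 := by rw [h1, h2]; simp

/-- `x` vanishes at infinity: the norms of the restrictions of `x` to the summands of degree at
least `m` tend to zero. -/
def VanishesAtInfty (x : Adjointable (List S) A) : Prop :=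
  ∀ ε > 0, ∃ m, ‖x * levels (Set.Ici m)‖ ≤ ε

/-- Windows of length `L > 2k` that are separated by gaps of length `L` do not interact under
`y`. -/
theorem norm_mul_sum_windows_le {k : ℕ} {y : Adjointable (List S) A} (hy : y ∈ finSpan u k)
    {L : ℕ} (hL : 2 * k < L) (m N : ℕ) {C : ℝ} (hC : 0 ≤ C)
    (h : ∀ i, m ≤ i → ‖y * levels (Set.Ico i (i + L))‖ ≤ C) :
    ‖∑ i ∈ Finset.range N, y * levels (Set.Ico (m + i * (2 * L)) (m + i * (2 * L) + L))‖ ≤ C := by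
  have hsep (i j : ℕ) (hij : i ≠ j) : i * (2 * L) + 2 * L ≤ j * (2 * L)
      ∨ j * (2 * L) + 2 * L ≤ i * (2 * L) := by
    rcases lt_or_gt_of_ne hij with h | h
    · left
      calc i * (2 * L) + 2 * L = (i + 1) * (2 * L) := by ring
        _ ≤ _ := Nat.mul_le_mul_right _ h
    · right
      calc j * (2 * L) + 2 * L = (j + 1) * (2 * L) := by ring
        _ ≤ _ := Nat.mul_le_mul_right _ h
  -- The images under `y` are orthogonal since the gaps exceed `2k`; the initial supports are
  -- orthogonal since the windows are disjoint.
  refine norm_sum_le_of_orthogonal _ _ hC (fun i _ => h _ (by omega)) ?_ ?_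
  · intro i _ j _ hij
    rw [star_mul, star_levels]
    refine levels_mul_star_mul_levels u hy fun a ha b hb => ?_
    have := hsep i j hij
    simp only [Set.mem_Ico] at ha hb
    omega
  · intro i _ j _ hij
    rw [star_mul, star_levels, mul_assoc, ← mul_assoc (levels _), levels_mul_of_disjoint]
    · simp
    · refine Set.disjoint_left.2 fun a ha hb => ?_
      have := hsep i j hij
      simp only [Set.mem_Ico] at ha hb
      omega

variable [Fintype S]

/-- An element of the Toeplitz-Pimsner algebra vanishes at infinity as soon as its restrictions to
the homogeneous summands tend to zero. -/
theorem vanishesAtInfty_of_tendsto {x : Adjointable (List S) A} (hx : x ∈ toeplitzPimsner u)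
    (h : ∀ ε > 0, ∃ M, ∀ m ≥ M, ‖x * levels {m}‖ ≤ ε) : VanishesAtInfty x := by
  intro δ hδ
  -- The budget is `2ε` for each of the two alternating families of windows and `ε` for replacing
  -- `x` by `y`.
  obtain ⟨ε, hε, rfl⟩ : ∃ ε > 0, δ = 5 * ε := ⟨δ / 5, by positivity, by ring⟩
  obtain ⟨k, y, hy, hxy⟩ := exists_finSpan_norm_sub_lt u hx hε
  set L := 2 * k + 1 with hL
  obtain ⟨M, hM⟩ := h (ε / L) (by positivity)
  have hdiff (Y : Set ℕ) : ‖x * levels Y - y * levels Y‖ ≤ ε := by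
    rw [← sub_mul]
    exact (norm_mul_levels_le _ _).trans hxy.le
  -- A window meets only `L` degrees, each contributing at most `ε / L` for `x`; passing to `y`
  -- costs another `ε`.
  have hwin (i : ℕ) (hi : M ≤ i) : ‖y * levels (Set.Ico i (i + L))‖ ≤ 2 * ε := by
    have h1 : ‖x * levels (Set.Ico i (i + L))‖ ≤ ε := by
      rw [levels_Ico_eq_sum, Finset.mul_sum]
      refine (norm_sum_le _ _).trans ((Finset.sum_le_card_nsmul _ _ (ε / L) fun j _ =>
        hM _ (by omega)).trans ?_)
      rw [Finset.card_range, nsmul_eq_mul, mul_div_cancel₀]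
      positivity
    have h2 := norm_sub_norm_le (y * levels (Set.Ico i (i + L))) (x * levels (Set.Ico i (i + L)))
    have h3 := hdiff (Set.Ico i (i + L))
    rw [norm_sub_rev] at h3
    linarith
  refine ⟨M, norm_mul_levels_Ici_le _ _ (by positivity) fun M' =>
    ⟨M + M' * (2 * L), by nlinarith, ?_⟩⟩
  have h1 := norm_mul_sum_windows_le u hy (L := L) (by omega) M M' (by positivity) hwin
  have h2 := norm_mul_sum_windows_le u hy (L := L) (by omega) (M + L) M' (by positivity)
    fun i hi => hwin i (by omega)
  have h3 : ‖y * levels (Set.Ico M (M + M' * (2 * L)))‖ ≤ 2 * ε + 2 * ε := by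
    rw [levels_Ico_eq_sum_windows, mul_add, Finset.mul_sum, Finset.mul_sum]
    exact (norm_add_le _ _).trans (add_le_add h1 h2)
  have h4 := norm_sub_norm_le (x * levels (Set.Ico M (M + M' * (2 * L))))
    (y * levels (Set.Ico M (M + M' * (2 * L))))
  have h5 := hdiff (Set.Ico M (M + M' * (2 * L)))
  linarith

end Levels

/-- Two successive limits, in `e'` for fixed `e` and then in `e`. This is how unavailable bare
isometries are replaced by `V_p π(e)` and `π(e') V_q*`. -/
theorem mem_of_forall_mul_mul_mem {A : Type*} [NonUnitalNormedRing A] {l : Filter A}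
    (hl : l.IsApproximateUnit) {C : Set A} (hC : IsClosed C) {b : A}
    (h : ∀ e e', e * b * e' ∈ C) : b ∈ C := by
  have := hl.neBot
  refine hC.mem_of_tendsto (hl.tendsto_mul_right b) (Eventually.of_forall fun e => ?_)
  exact hC.mem_of_tendsto (hl.tendsto_mul_left (e * b)) (Eventually.of_forall fun e' => h e e')

/-! ### The elements vanishing at infinity form a closed ideal -/

section Vanishing

variable {S A : Type*} [NonUnitalCStarAlgebra A]

theorem VanishesAtInfty.zero : VanishesAtInfty (0 : Adjointable (List S) A) :=
  fun ε hε => ⟨0, by simpa using hε.le⟩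

theorem VanishesAtInfty.add {x y : Adjointable (List S) A} (hx : VanishesAtInfty x)
    (hy : VanishesAtInfty y) : VanishesAtInfty (x + y) := by
  intro ε hε
  obtain ⟨m, hm⟩ := hx (ε / 2) (by positivity)
  obtain ⟨n, hn⟩ := hy (ε / 2) (by positivity)
  refine ⟨max m n, ?_⟩
  rw [add_mul]
  refine (norm_add_le _ _).trans ?_
  have h1 := norm_mul_levels_mono x (Set.Ici_subset_Ici.2 (le_max_left m n))
  have h2 := norm_mul_levels_mono y (Set.Ici_subset_Ici.2 (le_max_right m n))
  linarith

theorem VanishesAtInfty.neg {x : Adjointable (List S) A} (hx : VanishesAtInfty x) :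
    VanishesAtInfty (-x) := fun ε hε => by simpa [neg_mul] using hx ε hε

theorem VanishesAtInfty.mul_left {x : Adjointable (List S) A} (hx : VanishesAtInfty x)
    (y : Adjointable (List S) A) : VanishesAtInfty (y * x) := by
  intro ε hε
  obtain ⟨m, hm⟩ := hx (ε / (‖y‖ + 1)) (by positivity)
  refine ⟨m, ?_⟩
  rw [mul_assoc]
  calc _ ≤ ‖y‖ * (ε / (‖y‖ + 1)) := (norm_mul_le _ _).trans (by gcongr)
    _ ≤ (‖y‖ + 1) * (ε / (‖y‖ + 1)) := by gcongr; linarith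
    _ = ε := mul_div_cancel₀ _ (by positivity)

theorem isClosed_vanishesAtInfty :
    IsClosed {x : Adjointable (List S) A | VanishesAtInfty x} := by
  refine isClosed_of_closure_subset fun x hx ε hε => ?_
  obtain ⟨y, hy, hxy⟩ := Metric.mem_closure_iff.1 hx (ε / 2) (by positivity)
  obtain ⟨m, hm⟩ := hy (ε / 2) (by positivity)
  refine ⟨m, ?_⟩
  rw [dist_eq_norm] at hxy
  have h : x * levels (Set.Ici m) = (x - y) * levels (Set.Ici m) + y * levels (Set.Ici m) := by
    rw [← add_mul, sub_add_cancel]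
  rw [h]
  have h1 := norm_mul_levels_le (x - y) (Set.Ici m)
  exact (norm_add_le _ _).trans (by linarith)

theorem VanishesAtInfty.of_mem_compactOn {x : Adjointable (List S) A}
    (hx : x ∈ compactOn {([] : List S)}) : VanishesAtInfty x := by
  suffices h : x * levels (Set.Ici 1) = 0 from fun ε hε => ⟨1, by rw [h]; simpa using hε.le⟩
  have hc : IsClosed {x : Adjointable (List S) A | x * levels (Set.Ici 1) = 0} :=
    isClosed_eq (continuous_id.mul continuous_const) continuous_const
  refine closure_minimal (fun y hy => ?_) hc hx
  change y * levels (Set.Ici 1) = 0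
  induction hy using Submodule.span_induction with
  | zero => simp
  | add x y _ _ hx hy => rw [add_mul, hx, hy, add_zero]
  | smul c x _ hx => rw [smul_mul_assoc, hx, smul_zero]
  | mem x hx =>
    obtain ⟨ξ, η, -, hη, rfl⟩ := hx
    refine ext_apply fun f w => ?_
    change ξ w * ip η ((levels (Set.Ici 1)).1 f) = 0
    rw [ip, tsum_congr (g := fun _ => 0), tsum_zero, mul_zero]
    intro v
    by_cases hv : v = []
    · have : (levels (Set.Ici 1)).1 f v = 0 :=
        Set.indicator_of_notMem (s := {w : List S | w.length ∈ Set.Ici 1}) (by simp [hv]) _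
      rw [this, mul_zero]
    · rw [hη v hv, star_zero, zero_mul]

variable (u : S → A →⋆ₙₐ[ℂ] A)

/-- `y` lowers degrees by at most `k`, so it maps degrees at least `m + k` into degrees at least
`m`, where `x` is small. -/
theorem VanishesAtInfty.mul_right_of_mem_finSpan {x y : Adjointable (List S) A}
    (hx : VanishesAtInfty x) {k : ℕ} (hy : y ∈ finSpan u k) : VanishesAtInfty (x * y) := by
  intro ε hε
  obtain ⟨m, hm⟩ := hx (ε / (‖y‖ + 1)) (by positivity)
  have h1 : levels (Set.Ici m)ᶜ * y * levels (Set.Ici (m + k)) = 0 := by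
    refine levels_mul_mul_levels u hy fun i hi j hj => ?_
    simp only [Set.mem_compl_iff, Set.mem_Ici] at hi hj
    omega
  refine ⟨m + k, ?_⟩
  have h2 : x * y * levels (Set.Ici (m + k))
      = x * levels (Set.Ici m) * (y * levels (Set.Ici (m + k))) := by
    calc _ = x * ((levels (Set.Ici m) + levels (Set.Ici m)ᶜ) * (y * levels (Set.Ici (m + k)))) := by
          rw [levels_add_compl, one_mul, mul_assoc]
      _ = x * levels (Set.Ici m) * (y * levels (Set.Ici (m + k)))
          + x * (levels (Set.Ici m)ᶜ * y * levels (Set.Ici (m + k))) := by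
          rw [add_mul, mul_add]; simp only [mul_assoc]
      _ = _ := by rw [h1, mul_zero, add_zero]
  rw [h2]
  calc _ ≤ (ε / (‖y‖ + 1)) * ‖y‖ := (norm_mul_le _ _).trans (by
        gcongr
        exact norm_mul_levels_le _ _)
    _ ≤ (ε / (‖y‖ + 1)) * (‖y‖ + 1) := by gcongr; linarith
    _ = ε := div_mul_cancel₀ _ (by positivity)

theorem VanishesAtInfty.mul_right [Fintype S] {x y : Adjointable (List S) A}
    (hx : VanishesAtInfty x) (hy : y ∈ toeplitzPimsner u) : VanishesAtInfty (x * y) := by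
  have hc : IsClosed {y : Adjointable (List S) A | VanishesAtInfty (x * y)} :=
    isClosed_vanishesAtInfty.preimage (continuous_const.mul continuous_id)
  refine closure_minimal (fun y hy => ?_) hc (toeplitzPimsner_le u hy)
  obtain ⟨k, hk⟩ := exists_mem_finSpan u hy
  exact hx.mul_right_of_mem_finSpan u hk

/-- Each `υ_w` is injective, hence isometric, so `π(a)` has norm `‖a‖` on every degree. The test
vector `δ_w ⊗ υ_w(a)*`, with `w` any word of length `m`, shows `‖a‖² ≤ ε ‖a‖`. -/
theorem eq_zero_of_vanishesAtInfty_fockHom [Nonempty S] (hinj : ∀ s, Function.Injective (u s))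
    {a : A} (ha : VanishesAtInfty (fockHom u a)) : a = 0 := by
  refine norm_le_zero_iff.1 (le_of_forall_pos_le_add fun ε hε => ?_)
  obtain ⟨m, hm⟩ := ha ε hε
  obtain ⟨s⟩ := ‹Nonempty S›
  set w := List.replicate m s
  have h1 : (fockHom u a * levels (Set.Ici m)).1 (single w (star (wordHom u w a))) w
      = wordHom u w a * star (wordHom u w a) := by
    change wordHom u w a * {w : List S | w.length ∈ Set.Ici m}.indicator
      (single w (star (wordHom u w a))) w = _
    rw [Set.indicator_of_mem (by simp [w]), single_apply_self]
  have h2 := norm_apply_le_norm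
    ((fockHom u a * levels (Set.Ici m)).1 (single w (star (wordHom u w a)))) w
  have h3 := Adjointable.norm_apply_le (fockHom u a * levels (Set.Ici m))
    (single w (star (wordHom u w a)))
  rw [h1, CStarRing.norm_self_mul_star, norm_wordHom u hinj] at h2
  rw [norm_single, norm_star, norm_wordHom u hinj] at h3
  by_contra! hlt
  nlinarith [norm_nonneg a]

end Vanishing

/-! ### The compact corner in degree zero and its translates -/

section Corner

variable {S A : Type*} [NonUnitalCStarAlgebra A] {u : S → A →⋆ₙₐ[ℂ] A}

theorem matUnit_mem_of_forall {G : AddSubgroup (Adjointable (List S) A)} {l : Filter A}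
    (hl : l.IsApproximateUnit) (hG : IsClosed (G : Set (Adjointable (List S) A)))
    (p : List S) (b : A) (q : List S)
    (h : ∀ e e', (wordShift p * fockHom u e) * fockHom u b * (fockHom u e' * star (wordShift q))
      ∈ G) : matUnit u p b q ∈ G := by
  refine mem_of_forall_mul_mul_mem hl (hG.preimage (continuous_matUnit u p q)) fun e e' => ?_
  have := h e e'
  change matUnit u p (e * b * e') q ∈ G
  simpa only [matUnit, map_mul, mul_assoc] using this

theorem fockHom_mul_restrict (a : A) :
    fockHom u a * restrict {[]} = restrict {[]} * fockHom u a := by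
  refine ext_apply fun f w => ?_
  change wordHom u w a * ({[]} : Set (List S)).indicator f w
    = ({[]} : Set (List S)).indicator ((fockHom u a).1 f) w
  by_cases hw : w ∈ ({[]} : Set (List S)) <;> simp [hw, fockHom_apply]

theorem fockHom_mul_restrict_mem_compactOn {l : Filter A} (hl : l.IsApproximateUnit) (a : A) :
    fockHom u a * restrict {[]} ∈ compactOn {([] : List S)} := by
  have := hl.neBot
  have hc : Continuous fun b : A => fockHom u b * restrict {[]} :=
    (continuous_fockHom u).mul continuous_const
  refine isClosed_closure.mem_of_tendsto ((hc.tendsto a).comp (hl.tendsto_mul_left a))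
    (Eventually.of_forall fun e => subset_closure (Submodule.subset_span ?_))
  -- `π(a e)` cut down to degree zero is the rank one operator of `δ_∅ ⊗ a` and `δ_∅ ⊗ e*`.
  refine ⟨single [] a, single [] (star e), fun x hx => single_apply_of_ne hx _,
    fun x hx => single_apply_of_ne hx _, ext_apply fun f w => ?_⟩
  rw [theta_apply, rmul_apply, ip_single_left, star_star]
  change wordHom u w (a * e) * ({[]} : Set (List S)).indicator f w = _
  by_cases hw : w = []
  · subst hw
    simp [wordHom, mul_assoc]
  · rw [Set.indicator_of_notMem (show w ∉ ({[]} : Set (List S)) from hw),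
      single_apply_of_ne hw, mul_zero, zero_mul]

theorem restrict_coe_finset {X : Type*} (s : Finset X) :
    (restrict (s : Set X) : Adjointable X A) = ∑ x ∈ s, restrict {x} := by
  classical
  induction s using Finset.induction_on with
  | empty => simp
  | insert x s hx ih =>
    rw [Finset.sum_insert hx, ← ih, ← restrict_union (by simpa using hx), Finset.coe_insert,
      Set.insert_eq]

/-- Restricting a spanning operator to a single word leaves a translate of the degree-zero corner,
with coefficient `υ_v(a)`. -/
theorem matUnit_mul_restrict_append (p : List S) (a : A) (q v : List S) :
    matUnit u p a q * restrict {q ++ v}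
      = wordShift (p ++ v) * (fockHom u (wordHom u v a) * restrict {[]})
        * star (wordShift (q ++ v)) := by
  refine ext_apply fun f w => ?_
  change (matUnit u p a q).1 ((restrict {q ++ v}).1 f) w = (wordShift (p ++ v)).1
    ((fockHom u (wordHom u v a)).1 ((restrict {[]}).1 ((star (wordShift (q ++ v))).1 f))) w
  by_cases hp : p <+: w
  · obtain ⟨x, rfl⟩ := hp
    rw [matUnit_apply_append, restrict_apply]
    by_cases hv : v <+: x
    · obtain ⟨y, rfl⟩ := hv
      rw [← List.append_assoc p v y, wordShift_apply_append, fockHom_apply,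
        ← List.append_assoc q v y, restrict_apply, wordHom_append]
      by_cases hy : y = []
      · subst hy
        rw [Set.indicator_of_mem (by simp), Set.indicator_of_mem (by simp), star_wordShift_apply]
      · rw [Set.indicator_of_notMem, Set.indicator_of_notMem, mul_zero]
        · exact hy
        · simpa using hy
    · rw [wordShift_apply_of_not_prefix (by rwa [List.prefix_append_right_inj]),
        Set.indicator_of_notMem, mul_zero]
      intro h
      have : x = v := by simpa using h
      exact hv (this ▸ List.prefix_rfl)
  · rw [matUnit_apply_of_not_prefix u hp, wordShift_apply_of_not_prefix]
    exact fun h => hp ((List.prefix_append _ _).trans h)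

theorem matUnit_mul_restrict_of_not_prefix (p : List S) (a : A) {q v : List S} (h : ¬ q <+: v) :
    matUnit u p a q * restrict {v} = 0 := by
  refine ext_apply fun f w => ?_
  change (matUnit u p a q).1 ((restrict {v}).1 f) w = 0
  by_cases hp : p <+: w
  · obtain ⟨x, rfl⟩ := hp
    rw [matUnit_apply_append, restrict_apply, Set.indicator_of_notMem, mul_zero]
    rintro rfl
    exact h (List.prefix_append _ _)
  · rw [matUnit_apply_of_not_prefix u hp]

end Corner

/-! ### Closed ideals of the Toeplitz–Pimsner algebra; identification of the Pimsner ideal -/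

section Ideals

variable {S A : Type*} [NonUnitalCStarAlgebra A] [Fintype S] {u : S → A →⋆ₙₐ[ℂ] A}

/-- An ideal of the Toeplitz-Pimsner algebra as a group of operators on the Fock module. -/
def operatorIdeal (K : TwoSidedIdeal (toeplitzPimsner u)) : AddSubgroup (Adjointable (List S) A) where
  carrier := {x | ∃ hx : x ∈ toeplitzPimsner u, (⟨x, hx⟩ : toeplitzPimsner u) ∈ K}
  zero_mem' := ⟨zero_mem _, K.zero_mem⟩
  add_mem' := fun ⟨hx, hx'⟩ ⟨hy, hy'⟩ => ⟨add_mem hx hy, K.add_mem hx' hy'⟩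
  neg_mem' := fun ⟨hx, hx'⟩ => ⟨neg_mem hx, K.neg_mem hx'⟩

variable {K : TwoSidedIdeal (toeplitzPimsner u)}

theorem coe_mem_operatorIdeal {x : toeplitzPimsner u} :
    (x : Adjointable (List S) A) ∈ operatorIdeal K ↔ x ∈ K := ⟨fun h => h.2, fun h => ⟨x.2, h⟩⟩

theorem mem_of_mem_operatorIdeal {x : Adjointable (List S) A} (hx : x ∈ operatorIdeal K) :
    x ∈ toeplitzPimsner u := hx.1

theorem mul_mem_operatorIdeal_left {x y : Adjointable (List S) A} (hx : x ∈ toeplitzPimsner u)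
    (hy : y ∈ operatorIdeal K) : x * y ∈ operatorIdeal K :=
  ⟨mul_mem hx hy.1, K.mul_mem_left ⟨x, hx⟩ ⟨y, hy.1⟩ hy.2⟩

theorem mul_mem_operatorIdeal_right {x y : Adjointable (List S) A} (hx : x ∈ operatorIdeal K)
    (hy : y ∈ toeplitzPimsner u) : x * y ∈ operatorIdeal K :=
  ⟨mul_mem hx.1 hy, K.mul_mem_right ⟨x, hx.1⟩ ⟨y, hy⟩ hx.2⟩

theorem isClosed_operatorIdeal (hK : IsClosed (K : Set (toeplitzPimsner u))) :
    IsClosed (operatorIdeal K : Set (Adjointable (List S) A)) := by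
  have h := (isClosed_toeplitzPimsner u).isClosedEmbedding_subtypeVal.isClosedMap _ hK
  convert h using 1
  ext x
  constructor
  · rintro ⟨hx, hx'⟩
    exact ⟨⟨x, hx⟩, hx', rfl⟩
  · rintro ⟨y, hy, rfl⟩
    exact ⟨y.2, hy⟩

/-- A continuous additive map that sends all `V_p π(a) V_q^*` into a closed group sends the
Toeplitz-Pimsner algebra into it. -/
theorem map_mem_of_forall_matUnit_mem {G : AddSubgroup (Adjointable (List S) A)}
    (hG : IsClosed (G : Set (Adjointable (List S) A)))
    {R : Adjointable (List S) A →+ Adjointable (List S) A} (hR : Continuous R)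
    (h : ∀ p a q, R (matUnit u p a q) ∈ G)
    {x : Adjointable (List S) A} (hx : x ∈ toeplitzPimsner u) : R x ∈ G := by
  have h1 : ∀ y ∈ wordSpan u, R y ∈ G := by
    intro y hy
    -- `G` is only an additive group, so the span is generated additively by scalar multiples, and
    -- the scalar is absorbed into `a`.
    induction hy using Submodule.closure_induction with
    | zero => rw [map_zero]; exact zero_mem _
    | add x y _ _ hx hy => rw [map_add]; exact add_mem hx hy
    | smul_mem c x hx =>
      obtain ⟨p, a, q, rfl⟩ := hx
      rw [← matUnit_smul]
      exact h _ _ _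
  exact closure_minimal h1 (hG.preimage hR) (toeplitzPimsner_le u hx)

theorem fockHom_mul_star_wordShift_mem (hnd : ∀ s, IsNondegenerate (u s)) (a : A) (w : List S) :
    fockHom u a * star (wordShift w) ∈ toeplitzPimsner u := by
  have h := star_mem (wordShift_mul_fockHom_mem hnd w (star a))
  rwa [star_mul, ← map_star, star_star] at h

/-- An ideal that contains the image of `A` is everything. -/
theorem eq_top_of_forall_fockHom_mem (hnd : ∀ s, IsNondegenerate (u s)) {l : Filter A}
    (hl : l.IsApproximateUnit) (hK : IsClosed (K : Set (toeplitzPimsner u)))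
    (h : ∀ a, fockHom u a ∈ operatorIdeal K) : K = ⊤ := by
  refine eq_top_iff.2 fun x _ => coe_mem_operatorIdeal.1 ?_
  refine map_mem_of_forall_matUnit_mem (isClosed_operatorIdeal hK) (R := AddMonoidHom.id _)
    continuous_id (fun p a q => ?_) x.2
  refine matUnit_mem_of_forall hl (isClosed_operatorIdeal hK) p a q fun e e' => ?_
  exact mul_mem_operatorIdeal_right (mul_mem_operatorIdeal_left
    (wordShift_mul_fockHom_mem hnd p e) (h a)) (fockHom_mul_star_wordShift_mem hnd e' q)

/-- As `S` is finite, the part of `π(a)` on nonempty words is the finite sum of the `V_s π(υ_s(a))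
V_s*`, each of which lies in the algebra; subtracting it from `π(a)` leaves the corner. -/
theorem fockHom_mul_restrict_mem (hnd : ∀ s, IsNondegenerate (u s)) {l : Filter A}
    (hl : l.IsApproximateUnit) (a : A) :
    fockHom u a * restrict {[]} ∈ toeplitzPimsner u := by
  have h : fockHom u a * restrict {[]} = fockHom u a - ∑ s, matUnit u [s] (u s a) [s] := by
    refine ext_apply fun f w => ?_
    rw [Adjointable.sub_apply, Adjointable.sum_apply]
    change wordHom u w a * ({[]} : Set (List S)).indicator f w = wordHom u w a * f w - _
    cases w with
    | nil =>
      rw [Finset.sum_eq_zero fun s _ => matUnit_apply_of_not_prefix u (by simp) _ _ _]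
      simp
    | cons s w =>
      rw [Finset.sum_eq_single s]
      · have := matUnit_apply_append u [s] (u s a) [s] w f
        rw [List.singleton_append] at this
        rw [this]
        simp [wordHom]
      · intro t _ ht
        exact matUnit_apply_of_not_prefix u (by simpa using ht) _ _ _
      · simp
  rw [h]
  refine sub_mem (fockHom_mem u a) (sum_mem fun s _ => ?_)
  refine matUnit_mem_of_forall (G := (toeplitzPimsner u).toNonUnitalSubring.toAddSubgroup) hl
    (isClosed_toeplitzPimsner u) _ _ _ fun e e' => ?_
  exact show _ ∈ toeplitzPimsner u from
    mul_mem (mul_mem (wordShift_mul_fockHom_mem hnd _ e) (fockHom_mem u _))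
      (fockHom_mul_star_wordShift_mem hnd e' _)

/-- The degree-zero projection commutes with `π(e')`, so an approximate unit can be split off on
both sides to turn the isometries into multipliers from the algebra. -/
theorem shift_corner_mem_operatorIdeal (hnd : ∀ s, IsNondegenerate (u s)) {l : Filter A}
    (hl : l.IsApproximateUnit) (hK : IsClosed (K : Set (toeplitzPimsner u)))
    (hc : ∀ b, fockHom u b * restrict {[]} ∈ operatorIdeal K) (p : List S) (b : A) (q : List S) :
    wordShift p * (fockHom u b * restrict {[]}) * star (wordShift q) ∈ operatorIdeal K := by
  have hcont : Continuous fun b : A =>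
      wordShift p * (fockHom u b * restrict {[]}) * star (wordShift q) :=
    (((continuous_fockHom u).mul_const _).const_mul _).mul_const _
  refine mem_of_forall_mul_mul_mem hl ((isClosed_operatorIdeal hK).preimage hcont) fun e e' => ?_
  have h := mul_mem_operatorIdeal_right (mul_mem_operatorIdeal_left
    (wordShift_mul_fockHom_mem hnd p e) (hc b)) (fockHom_mul_star_wordShift_mem hnd e' q)
  have h2 : wordShift p * (fockHom u (e * b * e') * restrict {[]}) * star (wordShift q)
      = wordShift p * fockHom u e * (fockHom u b * restrict {[]})
        * (fockHom u e' * star (wordShift q)) := by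
    rw [map_mul, mul_assoc _ (fockHom u e'), fockHom_mul_restrict, map_mul]
    simp only [mul_assoc]
  rwa [Set.mem_preimage, h2]

/-- There are only finitely many words of length below `m`, so the degree projection is a finite sum
of projections onto single words. -/
theorem matUnit_mul_levels_Iio_mem {G : AddSubgroup (Adjointable (List S) A)}
    (hG : ∀ p b q, wordShift p * (fockHom u b * restrict {[]}) * star (wordShift q) ∈ G)
    (p : List S) (a : A) (q : List S) (m : ℕ) :
    matUnit u p a q * levels (Set.Iio m) ∈ G := by
  have hfin := List.finite_length_lt S m
  have hlev : (levels (Set.Iio m) : Adjointable (List S) A)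
      = ∑ v ∈ hfin.toFinset, restrict {v} := by
    rw [← restrict_coe_finset, hfin.coe_toFinset]
    rfl
  rw [hlev, Finset.mul_sum]
  refine sum_mem fun v _ => ?_
  by_cases hqv : q <+: v
  · obtain ⟨r, rfl⟩ := hqv
    rw [matUnit_mul_restrict_append]
    exact hG _ _ _
  · rw [matUnit_mul_restrict_of_not_prefix p a hqv]
    exact zero_mem _

/-- Elements of the Toeplitz-Pimsner algebra that vanish at infinity belong to each closed ideal
that contains the compact operators of the summand of degree zero. -/
theorem mem_operatorIdeal_of_vanishesAtInfty (hnd : ∀ s, IsNondegenerate (u s)) {l : Filter A}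
    (hl : l.IsApproximateUnit) (hK : IsClosed (K : Set (toeplitzPimsner u)))
    (hc : ∀ x : toeplitzPimsner u,
      (x : Adjointable (List S) A) ∈ compactOn {([] : List S)} → x ∈ K)
    {x : Adjointable (List S) A} (hx : x ∈ toeplitzPimsner u) (hv : VanishesAtInfty x) :
    x ∈ operatorIdeal K := by
  have hcl := isClosed_operatorIdeal hK
  have h0 (b : A) : fockHom u b * restrict {[]} ∈ operatorIdeal K :=
    ⟨fockHom_mul_restrict_mem hnd hl b, hc _ (fockHom_mul_restrict_mem_compactOn hl b)⟩
  have h2 (m : ℕ) : x * levels (Set.Iio m) ∈ operatorIdeal K :=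
    map_mem_of_forall_matUnit_mem hcl (R := AddMonoidHom.mulRight (levels (Set.Iio m)))
      (continuous_mul_const _)
      (fun p a q => matUnit_mul_levels_Iio_mem (shift_corner_mem_operatorIdeal hnd hl hK h0) p a q m)
      hx
  refine hcl.closure_subset (Metric.mem_closure_iff.2 fun ε hε => ?_)
  obtain ⟨m, hm⟩ := hv (ε / 2) (by positivity)
  refine ⟨_, h2 m, ?_⟩
  have h3 : x - x * levels (Set.Iio m) = x * levels (Set.Ici m) := by
    rw [sub_eq_iff_eq_add', ← mul_add, ← Set.compl_Iio, levels_add_compl, mul_one]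
  rw [dist_eq_norm, h3]
  linarith

/-- The ideal that defines the Cuntz-Pimsner algebra consists of the elements that vanish at
infinity. -/
theorem mem_pimsnerIdeal_iff (hnd : ∀ s, IsNondegenerate (u s)) {l : Filter A}
    (hl : l.IsApproximateUnit) {x : toeplitzPimsner u} :
    x ∈ pimsnerIdeal u ↔ VanishesAtInfty (x : Adjointable (List S) A) := by
  constructor
  · intro hx
    set N : TwoSidedIdeal (toeplitzPimsner u) :=
      TwoSidedIdeal.mk' {x | VanishesAtInfty (x : Adjointable (List S) A)} VanishesAtInfty.zero
        VanishesAtInfty.add VanishesAtInfty.neg (fun {x y} hy => hy.mul_left x.1)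
        (fun {x y} hx => hx.mul_right u y.2) with hN
    -- `N` is closed and contains the generators, so it is one of the ideals in the defining
    -- infimum.
    have h1 : pimsnerIdeal u ≤ N := by
      refine sInf_le ⟨?_, fun y hy => ?_⟩
      · rw [hN, TwoSidedIdeal.coe_mk']
        exact isClosed_vanishesAtInfty.preimage continuous_subtype_val
      · rw [hN, SetLike.mem_coe, TwoSidedIdeal.mem_mk']
        exact VanishesAtInfty.of_mem_compactOn hy
    have h2 := h1 hx
    rwa [hN, TwoSidedIdeal.mem_mk'] at h2
  · intro hx
    refine (TwoSidedIdeal.mem_sInf _).2 fun K hK => ?_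
    exact coe_mem_operatorIdeal.1 (mem_operatorIdeal_of_vanishesAtInfty hnd hl hK.1
      (fun y hy => hK.2 hy) x.2 hx)

end Ideals

/-- Functional calculus: `k` inverts `a* a` on the part where `a* a` exceeds `t`. -/
theorem exists_mul_star_mul_self_mul_eq {A : Type*} [NonUnitalCStarAlgebra A] (a : A) {t : ℝ}
    (ht : 0 < t) (hta : t < ‖star a * a‖) :
    ∃ k h : A, ‖k‖ ≤ 1 / t ∧ h ≠ 0 ∧ k * (star a * a) * h = h := by
  let _ := CStarAlgebra.spectralOrder A
  let _ := CStarAlgebra.spectralOrderedRing A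
  have hb0 : 0 ≤ star a * a := star_mul_self_nonneg a
  have hbsa : IsSelfAdjoint (star a * a) := .star_mul_self a
  generalize star a * a = b at *
  have hpos : ∀ x ∈ quasispectrum ℝ b, 0 ≤ x := fun x hx =>
    quasispectrum_nonneg_of_nonneg b hb0 x hx
  have hmax (x : ℝ) : 0 < max x t := lt_max_of_lt_right ht
  have hcont : Continuous fun r : ℝ => r / (max r t) ^ 2 :=
    continuous_id.div ((continuous_id.max continuous_const).pow 2) fun x => by
      have := hmax x
      positivity
  have hcont' : Continuous fun r : ℝ => max (r - t) 0 :=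
    (continuous_id.sub continuous_const).max continuous_const
  have h0 : max ((0 : ℝ) - t) 0 = 0 := by simp [ht.le]
  -- The first function is `1 / r` for `r ≥ t` but vanishes at `0`, as the non-unital calculus
  -- demands; its supremum is at most `1 / t`. The second lives on `r > t`, and if it gave `0`, the
  -- spectrum would lie in `[0, t]`, against `t < ‖b‖`.
  refine ⟨cfcₙ (fun r : ℝ => r / (max r t) ^ 2) b, cfcₙ (fun r : ℝ => max (r - t) 0) b, ?_, ?_, ?_⟩
  · refine norm_cfcₙ_le fun x hx => ?_
    have h1 := hpos x hx
    have h2 := hmax x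
    rw [Real.norm_of_nonneg (by positivity), div_le_div_iff₀ (by positivity) ht, one_mul, sq]
    exact mul_le_mul (le_max_left _ _) (le_max_right _ _) ht.le h2.le
  · intro h
    have h1 : ‖cfcₙ (id : ℝ → ℝ) b‖ ≤ t := by
      refine norm_cfcₙ_le fun x hx => ?_
      have h2 := norm_apply_le_norm_cfcₙ (fun r : ℝ => max (r - t) 0) b hx hcont'.continuousOn h0
      rw [h, norm_zero] at h2
      have h3 := le_max_left (x - t) 0
      have h4 := (le_abs_self _).trans h2
      rw [id, Real.norm_of_nonneg (hpos x hx)]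
      linarith
    rw [cfcₙ_id ℝ b] at h1
    exact absurd hta (not_lt.2 h1)
  · nth_rewrite 2 [← cfcₙ_id ℝ b]
    rw [← cfcₙ_mul _ _ b hcont.continuousOn (by simp) continuousOn_id rfl,
      ← cfcₙ_mul (fun x => x / max x t ^ 2 * id x) _ b (hcont.mul continuous_id).continuousOn (by simp) hcont'.continuousOn h0]
    refine cfcₙ_congr fun x hx => ?_
    rcases le_or_gt x t with hxt | hxt
    · simp [hxt]
    · simp only [max_eq_left hxt.le, id]
      field_simp [(ht.trans hxt).ne']

/-! ### A tail that makes words incomparable -/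

section Words

variable {S : Type*}

/-- If `γ = s ⋯ s t`, then the words `μ γ`, for `μ` shorter than `γ`, are pairwise incomparable. -/
theorem exists_word_not_prefix [Nontrivial S] (m : ℕ) :
    ∃ γ : List S, ∀ μ ν : List S, ν.length ≤ m → μ ≠ ν → ¬ μ ++ γ <+: ν ++ γ := by
  obtain ⟨s, t, hst⟩ := exists_pair_ne S
  refine ⟨List.replicate m s ++ [t], fun μ ν hν hne h => ?_⟩
  have hlen := h.length_le
  simp only [List.length_append] at hlen
  obtain ⟨ρ, hρ⟩ := h
  rcases (show μ.length ≤ ν.length by omega).eq_or_lt with he | hlt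
  · rw [List.append_assoc] at hρ
    exact hne (List.append_inj_left hρ he)
  -- Position `|μ| + m` holds the final `t` of `μγ`. In `νγ` it falls inside the block of `s`,
  -- because `|μ| < |ν| ≤ m`.
  · have h1 : (μ ++ (List.replicate m s ++ [t]) ++ ρ)[μ.length + m]? = some t := by
      rw [List.append_assoc, List.getElem?_append_right (by omega), List.append_assoc,
        List.getElem?_append_right (by simp)]
      simp
    have h2 : (ν ++ (List.replicate m s ++ [t]))[μ.length + m]? = some s := by
      rw [List.getElem?_append_right (by omega),
        List.getElem?_append_left (by rw [List.length_replicate]; omega),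
        List.getElem?_replicate_of_lt (by omega)]
    rw [hρ, h2] at h1
    exact hst (Option.some.inj h1)

end Words

/-! ### Compression of finite-propagation operators to the image of `A` -/

section Compression

variable {S A : Type*} [NonUnitalCStarAlgebra A] (u : S → A →⋆ₙₐ[ℂ] A)

/-- The operator `V_w π(b) V_γ`. -/
def tailShift (γ w : List S) (b : A) : Adjointable (List S) A :=
  wordShift (w ++ γ) * fockHom u (wordHom u γ b)

theorem star_tailShift (γ w : List S) (b : A) : star (tailShift u γ w b)
    = fockHom u (wordHom u γ (star b)) * star (wordShift (w ++ γ)) := by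
  rw [tailShift, star_mul, map_star, map_star]

theorem not_append_prefix {p w γ : List S} (hp : p.length ≤ w.length) (h : ¬ p <+: w) :
    ¬ p <+: w ++ γ ∧ ¬ w ++ γ <+: p := by
  constructor
  · exact fun h' => h (List.prefix_of_prefix_length_le h' (List.prefix_append _ _) hp)
  · intro h'
    have h1 : w <+: p := (List.prefix_append _ _).trans h'
    exact h (h1.eq_of_length_le hp ▸ List.prefix_rfl)

theorem star_tailShift_mul_tailShift {γ w v : List S} (h : w.length = v.length) (b c : A) :
    star (tailShift u γ w b) * tailShift u γ v c
      = fockHom u (wordHom u γ (ip (single w b) (single v c))) := by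
  rw [star_tailShift, tailShift, ip_single_left, mul_assoc, ← mul_assoc (star _)]
  by_cases hwv : w = v
  · subst hwv
    rw [star_wordShift_mul_self, one_mul, single_apply_self, map_mul, map_mul]
  · rw [single_apply_of_ne hwv, mul_zero, map_zero, map_zero,
      star_wordShift_mul_of_incomparable, zero_mul, mul_zero]
    · exact fun h' => hwv ((List.append_inj (h'.eq_of_length (by simp [h])) h).1)
    · exact fun h' => hwv ((List.append_inj (h'.eq_of_length (by simp [h])) h.symm).1).symm

/-- With `w = pμ` and `v = qν` the product contains `V_{μγ}* V_{νγ}`, which is zero unless `μ = ν`;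
so is the matrix coefficient on the right. Without the tail `γ`, comparable `μ` and `ν` of different
lengths would leave off-diagonal terms. -/
theorem star_tailShift_mul_matUnit_mul_tailShift {γ : List S} {m : ℕ}
    (hγ : ∀ μ ν : List S, ν.length ≤ m → μ ≠ ν → ¬ μ ++ γ <+: ν ++ γ) {w v p q : List S}
    (hw : w.length = m) (hv : v.length = m) (hp : p.length ≤ m) (hq : q.length ≤ m) (a b c : A) :
    star (tailShift u γ w b) * matUnit u p a q * tailShift u γ v c
      = fockHom u (wordHom u γ (ip (single w b) ((matUnit u p a q).1 (single v c)))) := by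
  have hL : star (tailShift u γ w b) * matUnit u p a q * tailShift u γ v c
      = fockHom u (wordHom u γ (star b)) * (star (wordShift (w ++ γ)) * wordShift p)
        * fockHom u a * (star (wordShift q) * wordShift (v ++ γ))
        * fockHom u (wordHom u γ c) := by
    rw [star_tailShift, tailShift, matUnit]; simp only [mul_assoc]
  rw [hL, ip_single_left]
  by_cases hpw : p <+: w
  swap
  · obtain ⟨h1, h2⟩ := not_append_prefix (γ := γ) (hp.trans hw.ge) hpw
    rw [matUnit_apply_of_not_prefix u hpw, star_wordShift_mul_of_incomparable h2 h1]
    simp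
  obtain ⟨μ, rfl⟩ := hpw
  rw [matUnit_apply_append]
  by_cases hqv : q <+: v
  swap
  · obtain ⟨h1, h2⟩ := not_append_prefix (γ := γ) (hq.trans hv.ge) hqv
    rw [star_wordShift_mul_of_incomparable h1 h2, single_apply_of_ne]
    · simp
    · rintro rfl
      exact hqv (List.prefix_append _ _)
  obtain ⟨ν, rfl⟩ := hqv
  rw [List.append_assoc, List.append_assoc, star_wordShift_append_mul, star_wordShift_mul_append,
    mul_assoc _ (fockHom u a), fockHom_mul_wordShift, mul_assoc _ (star _), ← mul_assoc (star _)]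
  by_cases hμν : μ = ν
  · subst hμν
    rw [star_wordShift_mul_self, one_mul, single_apply_self, wordHom_append]
    simp only [map_mul, mul_assoc]
  · rw [List.length_append] at hw hv
    rw [star_wordShift_mul_of_incomparable (hγ _ _ (by omega) hμν)
      (hγ _ _ (by omega) (Ne.symm hμν)), single_apply_of_ne]
    · simp
    · simpa using hμν

/-- The operator `T_f V_γ` for a vector `f` supported in the finite set `F` of words. -/
def tailCreation (γ : List S) (F : Finset (List S)) (f : Fock S A) : Adjointable (List S) A :=
  ∑ w ∈ F, tailShift u γ w (f w)

/-- All words in `F` have the same length, so distinct ones stay incomparable after appending `γ`,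
and `R* R = π(υ_γ(⟨f, f⟩))`. -/
theorem norm_tailCreation_le {γ : List S} {m : ℕ} {F : Finset (List S)}
    (hF : ∀ w ∈ F, w.length = m) {f : Fock S A} (hf : ∀ w ∉ F, f w = 0) :
    ‖tailCreation u γ F f‖ ≤ ‖f‖ := by
  have h : star (tailCreation u γ F f) * tailCreation u γ F f
      = fockHom u (wordHom u γ (ip f f)) := by
    have h1 : ip f f = ∑ w ∈ F, ∑ v ∈ F, ip (single w (f w)) (single v (f v)) := by
      conv_lhs => rw [eq_sum_single hf, ip_sum_left]
      exact Finset.sum_congr rfl fun w _ => ip_sum_right _ _ _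
    rw [h1, tailCreation, star_sum, Finset.sum_mul, map_sum, map_sum]
    refine Finset.sum_congr rfl fun w hw => ?_
    rw [Finset.mul_sum, map_sum, map_sum]
    exact Finset.sum_congr rfl fun v hv =>
      star_tailShift_mul_tailShift u ((hF w hw).trans (hF v hv).symm) _ _
  refine (abs_le_of_sq_le_sq' ?_ (norm_nonneg _)).2
  rw [norm_sq, sq, ← CStarRing.norm_star_mul_self, h]
  exact (norm_fockHom_le u _).trans (NonUnitalStarAlgHom.norm_apply_le _ _)

/-- Both sides are linear in `y`, and for a spanning operator both expand over pairs of words in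
`F`. This compression does the work of a conditional expectation onto the degree-preserving part. -/
theorem star_tailCreation_mul_mul_tailCreation {γ : List S} {m : ℕ}
    (hγ : ∀ μ ν : List S, ν.length ≤ m → μ ≠ ν → ¬ μ ++ γ <+: ν ++ γ) {F : Finset (List S)}
    (hF : ∀ w ∈ F, w.length = m) {f : Fock S A} (hf : ∀ w ∉ F, f w = 0)
    {y : Adjointable (List S) A} (hy : y ∈ finSpan u m) :
    star (tailCreation u γ F f) * y * tailCreation u γ F f
      = fockHom u (wordHom u γ (ip f (y.1 f))) := by
  induction hy using Submodule.span_induction with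
  | zero =>
    have : ip f ((0 : Adjointable (List S) A).1 f) = 0 := by
      have h := ip_smul_right (0 : ℂ) f f
      rwa [zero_smul, zero_smul] at h
    rw [this]
    simp
  | add x y _ _ hx hy =>
    have : ip f ((x + y).1 f) = ip f (x.1 f) + ip f (y.1 f) := ip_add_right _ _ _
    rw [mul_add, add_mul, hx, hy, this, map_add, map_add]
  | smul c x _ hx =>
    have : ip f ((c • x).1 f) = c • ip f (x.1 f) := ip_smul_right _ _ _
    rw [mul_smul_comm, smul_mul_assoc, hx, this, map_smul, map_smul]
  | mem y h =>
    obtain ⟨p, a, q, hp, hq, rfl⟩ := h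
    have h1 : ip f ((matUnit u p a q).1 f)
        = ∑ w ∈ F, ∑ v ∈ F, ip (single w (f w)) ((matUnit u p a q).1 (single v (f v))) := by
      conv_lhs => rw [eq_sum_single hf, map_sum, ip_sum_left]
      exact Finset.sum_congr rfl fun w _ => ip_sum_right _ _ _
    rw [h1, tailCreation, star_sum, Finset.sum_mul, Finset.sum_mul, map_sum, map_sum]
    refine Finset.sum_congr rfl fun w hw => ?_
    rw [Finset.mul_sum, map_sum, map_sum]
    exact Finset.sum_congr rfl fun v hv =>
      star_tailShift_mul_matUnit_mul_tailShift u hγ (hF w hw) (hF v hv) hp hq _ _ _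

end Compression

/-! ### Ideals not contained in the Pimsner ideal; passage to the quotient -/

section Simplicity

variable {S A : Type*} [NonUnitalCStarAlgebra A] [Fintype S] {u : S → A →⋆ₙₐ[ℂ] A}
  {K : TwoSidedIdeal (toeplitzPimsner u)}

/-- The summands are written as `V_{wγ} π(·)`, so membership does not require `V_γ` itself to lie in
the algebra. -/
theorem tailCreation_mem (hnd : ∀ s, IsNondegenerate (u s)) (γ : List S) (F : Finset (List S))
    (f : Fock S A) : tailCreation u γ F f ∈ toeplitzPimsner u :=
  sum_mem fun _ _ => wordShift_mul_fockHom_mem hnd _ _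

/-- A closed ideal that comes closer to `π(a)` than `‖a‖` contains `π(h)` for some `h ≠ 0`. -/
theorem exists_fockHom_mem_of_norm_sub_lt (hK : IsClosed (K : Set (toeplitzPimsner u))) {a : A}
    {x : Adjointable (List S) A} (hx : x ∈ operatorIdeal K) (hax : ‖fockHom u a - x‖ < ‖a‖) :
    ∃ h ≠ 0, fockHom u h ∈ operatorIdeal K := by
  have ha : 0 < ‖a‖ := (norm_nonneg _).trans_lt hax
  set x' := fockHom u (star a) * x with hx'
  have hd : ‖fockHom u (star a * a) - x'‖ ≤ ‖a‖ * ‖fockHom u a - x‖ := by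
    rw [map_mul, hx', ← mul_sub]
    refine (norm_mul_le _ _).trans ?_
    gcongr
    exact (norm_fockHom_le u _).trans (norm_star a).le
  have hlt : ‖fockHom u (star a * a) - x'‖ < ‖star a * a‖ := by
    rw [CStarRing.norm_star_mul_self]
    exact hd.trans_lt (by gcongr)
  obtain ⟨t, ht1, ht2⟩ := exists_between hlt
  have ht0 : 0 < t := (norm_nonneg _).trans_lt ht1
  obtain ⟨k, h, hk, hh, hkh⟩ := exists_mul_star_mul_self_mul_eq a ht0 ht2
  refine ⟨h, hh, ?_⟩
  -- Modulo `K`, `E` is `π(k a* a)`, which fixes `π(h)`; yet `‖E‖ < 1`. Iterating `π(h) ≡ E π(h)`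
  -- drives `π(h)` to `0` modulo the closed ideal.
  set E := fockHom u k * (fockHom u (star a * a) - x') with hE
  have hE1 : ‖E‖ < 1 := by
    calc ‖E‖ ≤ 1 / t * ‖fockHom u (star a * a) - x'‖ := (norm_mul_le _ _).trans (by
          gcongr
          exact (norm_fockHom_le u k).trans hk)
      _ < 1 / t * t := by gcongr
      _ = 1 := by field_simp
  have hET : E ∈ toeplitzPimsner u :=
    mul_mem (fockHom_mem u k) (sub_mem (fockHom_mem u _)
      (mul_mem (fockHom_mem u _) (mem_of_mem_operatorIdeal hx)))
  have h1 : fockHom u h - E * fockHom u h ∈ operatorIdeal K := by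
    have h2 : fockHom u h - E * fockHom u h = fockHom u k * x' * fockHom u h := by
      rw [hE, mul_sub, sub_mul, ← map_mul, ← map_mul, hkh, sub_sub_cancel]
    rw [h2]
    exact mul_mem_operatorIdeal_right (mul_mem_operatorIdeal_left (fockHom_mem u k)
      (mul_mem_operatorIdeal_left (fockHom_mem u _) hx)) (fockHom_mem u h)
  have h2 (n : ℕ) : fockHom u h - E ^ n * fockHom u h ∈ operatorIdeal K := by
    induction n with
    | zero => simp
    | succ n ih =>
      have h3 := add_mem h1 (mul_mem_operatorIdeal_left hET ih)
      rwa [mul_sub, ← mul_assoc, ← pow_succ', sub_add_sub_cancel] at h3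
  have h3 : Tendsto (fun n : ℕ => fockHom u h - E ^ n * fockHom u h) atTop
      (𝓝 (fockHom u h - 0 * fockHom u h)) :=
    ((tendsto_pow_atTop_nhds_zero_of_norm_lt_one hE1).mul_const _).const_sub _
  rw [zero_mul, sub_zero] at h3
  exact (isClosed_operatorIdeal hK).mem_of_tendsto h3 (Eventually.of_forall h2)

/-- A closed ideal with an element that does not vanish at infinity meets the image of `A`. -/
theorem exists_fockHom_mem_of_not_vanishesAtInfty [Nontrivial S]
    (hinj : ∀ s, Function.Injective (u s)) (hnd : ∀ s, IsNondegenerate (u s))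
    (hK : IsClosed (K : Set (toeplitzPimsner u))) {z : Adjointable (List S) A}
    (hz : z ∈ operatorIdeal K) (hv : ¬ VanishesAtInfty z) :
    ∃ h ≠ 0, fockHom u h ∈ operatorIdeal K := by
  have hzT := mem_of_mem_operatorIdeal hz
  obtain ⟨δ, hδ, hlev⟩ : ∃ δ > 0, ∀ M, ∃ m ≥ M, δ < ‖z * levels {m}‖ := by
    by_contra! hc
    exact hv (vanishesAtInfty_of_tendsto u hzT hc)
  have hxI : star z * z ∈ operatorIdeal K := mul_mem_operatorIdeal_left (star_mem hzT) hz
  -- The error `δ² / 4` is spent twice, once in the compressed operator and once in `⟨f, y f⟩`,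
  -- while `⟨f, z* z f⟩` has norm above `δ² ‖f‖²`.
  obtain ⟨k, y, hy, hxy⟩ := exists_finSpan_norm_sub_lt u (mem_of_mem_operatorIdeal hxI)
    (ε := δ ^ 2 / 4) (by positivity)
  -- A degree `m ≥ k` ensures that the words occurring in `y` are no longer than those supporting
  -- `f`.
  obtain ⟨m, hkm, hm⟩ := hlev k
  obtain ⟨g, hg⟩ : ∃ g : Fock S A, δ * ‖g‖ < ‖(z * levels {m}).1 g‖ := by
    by_contra! hc
    exact absurd hm (not_lt.2 (norm_le_of_forall _ hδ.le hc))
  set f := (levels {m}).1 g with hf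
  have hfg : ‖f‖ ≤ ‖g‖ := by
    have h1 := Adjointable.norm_apply_le (levels {m}) g
    have h2 := norm_levels_le (S := S) (A := A) {m}
    nlinarith [norm_nonneg g]
  have hzf : δ * ‖f‖ < ‖z.1 f‖ := lt_of_le_of_lt (by gcongr) hg
  have hfin := List.finite_length_eq S m
  have hF : ∀ w ∈ hfin.toFinset, w.length = m := fun w hw => by simpa using hw
  have hfF : ∀ w ∉ hfin.toFinset, f w = 0 := fun w hw => by
    refine Set.indicator_of_notMem (s := {w : List S | w.length ∈ ({m} : Set ℕ)}) ?_ g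
    simpa using hw
  obtain ⟨γ, hγ⟩ := exists_word_not_prefix (S := S) m
  set R := tailCreation u γ hfin.toFinset f with hR
  have hRT : R ∈ toeplitzPimsner u := tailCreation_mem hnd _ _ _
  have hRn : ‖R‖ ≤ ‖f‖ := norm_tailCreation_le u hF hfF
  have hRy : star R * y * R = fockHom u (wordHom u γ (ip f (y.1 f))) :=
    star_tailCreation_mul_mul_tailCreation u hγ hF hfF (finSpan_mono u hkm hy)
  have hX : star R * (star z * z) * R ∈ operatorIdeal K :=
    mul_mem_operatorIdeal_right (mul_mem_operatorIdeal_left (star_mem hRT) hxI) hRT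
  refine exists_fockHom_mem_of_norm_sub_lt hK (a := wordHom u γ (ip f (y.1 f))) hX ?_
  have hdist : ‖fockHom u (wordHom u γ (ip f (y.1 f))) - star R * (star z * z) * R‖
      ≤ δ ^ 2 / 4 * ‖f‖ ^ 2 := by
    rw [← hRy, ← sub_mul, ← mul_sub]
    calc _ ≤ ‖f‖ * (δ ^ 2 / 4) * ‖f‖ := by
          refine (norm_mul_le _ _).trans (mul_le_mul ((norm_mul_le _ _).trans
            (mul_le_mul ?_ ?_ (norm_nonneg _) (norm_nonneg _))) hRn (norm_nonneg _)
            (by positivity))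
          · rwa [norm_star]
          · rw [norm_sub_rev]; exact hxy.le
      _ = _ := by ring
  have hc1 : ‖ip f ((star z * z).1 f)‖ = ‖z.1 f‖ ^ 2 := by
    rw [norm_sq, ip_apply_left z f (z.1 f)]; rfl
  have hc2 : ‖ip f ((star z * z).1 f) - ip f (y.1 f)‖ ≤ δ ^ 2 / 4 * ‖f‖ ^ 2 := by
    rw [← ip_sub_right]
    refine (norm_ip_le _ _).trans ?_
    have h1 := Adjointable.norm_apply_le (star z * z - y) f
    calc _ ≤ ‖f‖ * (δ ^ 2 / 4 * ‖f‖) := by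
          gcongr
          exact h1.trans (by gcongr)
      _ = _ := by ring
  have hc3 := norm_sub_norm_le (ip f ((star z * z).1 f)) (ip f (y.1 f))
  have hc4 : (δ * ‖f‖) ^ 2 < ‖z.1 f‖ ^ 2 := by gcongr
  rw [norm_wordHom u hinj]
  nlinarith [sq_nonneg (δ * ‖f‖)]

/-- Minimality is applied to the preimage of `K` under `π`, which is nonzero as soon as `K` has an
element that does not vanish at infinity. -/
theorem le_pimsnerIdeal_or_eq_top [Nontrivial S] (hinj : ∀ s, Function.Injective (u s))
    (hnd : ∀ s, IsNondegenerate (u s))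
    (hu : ∀ I : TwoSidedIdeal A, IsClosed (I : Set A) → (∀ s, ∀ a ∈ I, u s a ∈ I) →
      I = ⊥ ∨ I = ⊤) (hK : IsClosed (K : Set (toeplitzPimsner u))) :
    K ≤ pimsnerIdeal u ∨ K = ⊤ := by
  obtain ⟨s₀⟩ : Nonempty S := inferInstance
  obtain ⟨l, hl, -⟩ := hnd s₀
  by_cases hv : ∀ x ∈ operatorIdeal K, VanishesAtInfty x
  · exact .inl fun x hx => (mem_pimsnerIdeal_iff hnd hl).2 (hv _ (coe_mem_operatorIdeal.2 hx))
  right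
  push Not at hv
  obtain ⟨z, hz, hzv⟩ := hv
  obtain ⟨h, hh, hhK⟩ := exists_fockHom_mem_of_not_vanishesAtInfty hinj hnd hK hz hzv
  set I : TwoSidedIdeal A := TwoSidedIdeal.mk' {a | fockHom u a ∈ operatorIdeal K}
    (by simp [zero_mem])
    (fun {a b} ha hb => by
      change fockHom u (a + b) ∈ operatorIdeal K
      rw [map_add]; exact add_mem ha hb)
    (fun {a} ha => by
      change fockHom u (-a) ∈ operatorIdeal K
      rw [map_neg]; exact neg_mem ha)
    (fun {a b} hb => by
      change fockHom u (a * b) ∈ operatorIdeal K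
      rw [map_mul]; exact mul_mem_operatorIdeal_left (fockHom_mem u a) hb)
    (fun {a b} ha => by
      change fockHom u (a * b) ∈ operatorIdeal K
      rw [map_mul]; exact mul_mem_operatorIdeal_right ha (fockHom_mem u b)) with hI
  have hmem (a : A) : a ∈ I ↔ fockHom u a ∈ operatorIdeal K := by
    rw [hI, TwoSidedIdeal.mem_mk']; rfl
  have hcl : IsClosed {a | fockHom u a ∈ operatorIdeal K} :=
    (isClosed_operatorIdeal hK).preimage (continuous_fockHom u)
  have hIcl : IsClosed (I : Set A) := by
    rw [hI, TwoSidedIdeal.coe_mk']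
    exact hcl
  -- Invariance comes from `V_s* π(a) V_s = π(υ_s(a))`, with `e` and `e'` inserted to keep the
  -- factors in the algebra.
  have hinv (s : S) (a : A) (ha : a ∈ I) : u s a ∈ I := by
    rw [hmem] at ha ⊢
    refine mem_of_forall_mul_mul_mem hl hcl fun e e' => ?_
    have h1 := mul_mem_operatorIdeal_right (mul_mem_operatorIdeal_left
      (fockHom_mul_star_wordShift_mem hnd e [s]) ha) (wordShift_mul_fockHom_mem hnd [s] e')
    have h2 : fockHom u e * star (wordShift [s]) * fockHom u a * (wordShift [s] * fockHom u e')
        = fockHom u (e * u s a * e') := by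
      rw [mul_assoc _ _ (fockHom u a), star_wordShift_mul_fockHom, map_mul, map_mul]
      calc _ = fockHom u e * fockHom u (wordHom u [s] a)
            * (star (wordShift [s]) * wordShift [s]) * fockHom u e' := by simp only [mul_assoc]
        _ = _ := by rw [star_wordShift_mul_self, mul_one]; rfl
    rwa [h2] at h1
  rcases hu I hIcl hinv with hbot | htop
  · have h1 : h ∈ I := (hmem h).2 hhK
    rw [hbot] at h1
    exact absurd h1 hh
  · exact eq_top_of_forall_fockHom_mem hnd hl hK fun a => (hmem a).1 (htop ▸ trivial)

/-- The quotient map onto the Cuntz-Pimsner algebra. -/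
def toCuntzPimsner (u : S → A →⋆ₙₐ[ℂ] A) (x : toeplitzPimsner u) : CuntzPimsner u :=
  Quotient.mk (pimsnerIdeal u).ringCon.toSetoid x

theorem toCuntzPimsner_zero : toCuntzPimsner u 0 = 0 := rfl

theorem toCuntzPimsner_add (x y : toeplitzPimsner u) :
    toCuntzPimsner u (x + y) = toCuntzPimsner u x + toCuntzPimsner u y := rfl

theorem toCuntzPimsner_neg (x : toeplitzPimsner u) :
    toCuntzPimsner u (-x) = -toCuntzPimsner u x := rfl

theorem toCuntzPimsner_mul (x y : toeplitzPimsner u) :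
    toCuntzPimsner u (x * y) = toCuntzPimsner u x * toCuntzPimsner u y := rfl

theorem continuous_toCuntzPimsner : Continuous (toCuntzPimsner u) := continuous_quotient_mk'

theorem toCuntzPimsner_surjective : Function.Surjective (toCuntzPimsner u) := Quotient.exists_rep

theorem toCuntzPimsner_eq_zero_iff {x : toeplitzPimsner u} :
    toCuntzPimsner u x = 0 ↔ x ∈ pimsnerIdeal u :=
  Quotient.eq (r := (pimsnerIdeal u).ringCon.toSetoid)

/-- The preimage in the Toeplitz-Pimsner algebra of an ideal of the Cuntz-Pimsner algebra. -/
def preimageIdeal (I : TwoSidedIdeal (CuntzPimsner u)) : TwoSidedIdeal (toeplitzPimsner u) :=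
  TwoSidedIdeal.mk' {x | toCuntzPimsner u x ∈ I}
    (by rw [Set.mem_ofPred_eq, toCuntzPimsner_zero]; exact I.zero_mem)
    (fun {x y} hx hy => by
      rw [Set.mem_ofPred_eq, toCuntzPimsner_add]; exact I.add_mem hx hy)
    (fun {x} hx => by
      rw [Set.mem_ofPred_eq, toCuntzPimsner_neg]; exact I.neg_mem hx)
    (fun {x y} hy => by
      rw [Set.mem_ofPred_eq, toCuntzPimsner_mul]; exact I.mul_mem_left _ _ hy)
    (fun {x y} hx => by
      rw [Set.mem_ofPred_eq, toCuntzPimsner_mul]; exact I.mul_mem_right _ _ hx)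

theorem coe_preimageIdeal (I : TwoSidedIdeal (CuntzPimsner u)) :
    (preimageIdeal I : Set (toeplitzPimsner u)) = toCuntzPimsner u ⁻¹' I :=
  TwoSidedIdeal.coe_mk' ..

theorem mem_preimageIdeal {I : TwoSidedIdeal (CuntzPimsner u)} {x : toeplitzPimsner u} :
    x ∈ preimageIdeal I ↔ toCuntzPimsner u x ∈ I := by
  rw [← SetLike.mem_coe, coe_preimageIdeal, Set.mem_preimage, SetLike.mem_coe]

end Simplicity

end Pimsner

end

open Pimsner in
theorem theorem6p5 {A : Type*} [NonUnitalCStarAlgebra A] [Nontrivial A]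
    {S : Type*} [Fintype S] (hS : 2 ≤ Fintype.card S)
    (u : S → A →⋆ₙₐ[ℂ] A)
    (hinj : ∀ s, Function.Injective (u s))
    (hnd : ∀ s, Pimsner.IsNondegenerate (u s))
    (hu : ∀ I : TwoSidedIdeal A, IsClosed (I : Set A) → (∀ s, ∀ a ∈ I, u s a ∈ I) →
      I = ⊥ ∨ I = ⊤) :
    Pimsner.IsTopSimple (Pimsner.CuntzPimsner u) := by
  have : Nontrivial S := Fintype.one_lt_card_iff_nontrivial.1 hS
  obtain ⟨s₀⟩ : Nonempty S := inferInstance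
  obtain ⟨l, hl, -⟩ := hnd s₀
  refine ⟨?_, fun I hI => ?_⟩
  · obtain ⟨a, ha⟩ := exists_ne (0 : A)
    set x : toeplitzPimsner u := ⟨fockHom u a, fockHom_mem u a⟩ with hx
    refine ⟨toCuntzPimsner u x, 0, fun h => ha ?_⟩
    have h1 : VanishesAtInfty (x : Adjointable (List S) A) :=
      (mem_pimsnerIdeal_iff hnd hl).1 (toCuntzPimsner_eq_zero_iff.1 h)
    exact eq_zero_of_vanishesAtInfty_fockHom u hinj h1
  · have hK : IsClosed (preimageIdeal I : Set (toeplitzPimsner u)) := by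
      rw [coe_preimageIdeal]
      exact hI.preimage continuous_toCuntzPimsner
    rcases le_pimsnerIdeal_or_eq_top hinj hnd hu hK with h | h
    · left
      refine eq_bot_iff.2 fun b hb => ?_
      obtain ⟨x, rfl⟩ := toCuntzPimsner_surjective b
      exact toCuntzPimsner_eq_zero_iff.2 (h (mem_preimageIdeal.2 hb))
    · right
      refine eq_top_iff.2 fun b _ => ?_
      obtain ⟨x, rfl⟩ := toCuntzPimsner_surjective b
      exact mem_preimageIdeal.1 (h ▸ trivial)
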